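/- Let $\mathcal H$ be a complex Hilbert space of finite dimension $d\ge 2$ (e.g. $d=2^N$ for $N$ qubits). Consider a parameterized quantum circuit $\mathbf U(\theta)=U_M(\theta_M)W_M\cdots U_1(\theta_1)W_1$ with real parameters $\theta=(\theta_1,\dots,\theta_M)$, where $U_\mu(\theta_\mu)=e^{-i\theta_\mu\Omega_\mu}$ with Hermitian generators $\Omega_\mu$ and the $W_\mu$ are fixed unitaries. Let $|\psi(\theta)\rangle=\mathbf U(\theta)|\psi_{\rm in}\rangle$ for a fixed unit vector $|\psi_{\rm in}\rangle$, and let $$\mathcal F_{\mu\nu}(\theta)=2\,\mathrm{Re}\big[\langle\partial_\mu\psi|\partial_\nu\psi\rangle-\langle\partial_\mu\psi|\psi\rangle\langle\psi|\partial_\nu\psi\rangle\big]$$ be its quantum Fisher information matrix. Let $H$ be a Hermitian operator on $\mathcal H$ and fix a parameter point $\theta^*$; a superscript $*$ denotes evaluation at $\theta^*$, and $\langle A\rangle_*=\langle\psi^*|A|\psi^*\rangle$ with $\psi^*=\psi(\theta^*)$. Let $\mathbb V$ be the ensemble of random unitaries $V=|\psi^*\rangle\langle\psi^*|+PUP$,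 where $P=I-|\psi^*\rangle\langle\psi^*|$ and $U$ is Haar-random on the unitary group of the orthogonal complement of $\psi^*$. It induces an ensemble of energy losses $$\mathcal L(\theta)=\langle\psi(\theta)|V^\dagger HV|\psi(\theta)\rangle ,$$ and we write $\mathcal L^*=\langle H\rangle_*$ for the value at $\theta^*$, which is common to all $V$ because $V\psi^*=\psi^*$. Every such $\mathcal L$ is a smooth function of $\theta$, its first and second partial derivatives at $\theta^*$ are square-integrable random variables of $V$, and for all $\mu,\nu\in\{1,\dots,M\}$ $$\mathbb E_{\mathbb V}[\partial_\mu\mathcal L^*]=0,\qquad \mathrm{Var}_{\mathbb V}[\partial_\mu\mathcal L^*]=\frac{\langle H^2\rangle_*-\langle H\rangle_*^2}{d-1}\,\mathcal F^*_{\mu\mu},\qquad \mathbb E_{\mathbb V}[\partial_\mu\partial_\nu\mathcal L^*]=\frac{\mathrm{tr}\,H-d\,\mathcal L^*}{d-1}\,\mathcal F^*_{\mu\nu},$$ and, if $d\ge 3$, $$\mathrm{Var}_{\mathbb V}[\partial_\mu\partial_\nu\mathcal L^*]\le 32\left(\frac{\langle H^2\rangle_*-\langle H\rangle_*^2}{d-1}+\frac{2\|H\|_2^2}{d(d-2)}\right)\|\Omega_\mu\|_\infty^2\,\|\Omega_\nu\|_\infty^2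 ,$$ where $\|\cdot\|_2$ is the Schatten-2 (Hilbert–Schmidt) norm and $\|\cdot\|_\infty$ is the operator norm. -/

import Mathlib

open MeasureTheory

noncomputable section

section Operators

variable {E : Type*} [NormedAddCommGroup E] [InnerProductSpace ℂ E] [CompleteSpace E]

/-- The expectation value `⟨A⟩ = ⟨ψ|A|ψ⟩` (its real part; it is real when `A` is Hermitian). -/
def expval (ψ : E) (A : E →L[ℂ] E) : ℝ := (inner ℂ ψ (A ψ)).re

/-- The trace of an operator (its real part; it is real when `A` is Hermitian). -/
def trRe (A : E →L[ℂ] E) : ℝ := (LinearMap.trace ℂ E (A : E →ₗ[ℂ] E)).re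

/-- The Schatten-2 (Hilbert-Schmidt, Frobenius) norm `‖A‖₂ = √(tr (A† A))`. -/
def schattenTwoNorm (A : E →L[ℂ] E) : ℝ := Real.sqrt (trRe (star A * A))

end Operators

/-- The partial derivative `∂_μ f (θ)` of a function of `M` real parameters. -/
def partialDeriv {M : ℕ} {F : Type*} [NormedAddCommGroup F] [NormedSpace ℝ F]
    (μ : Fin M) (f : (Fin M → ℝ) → F) (θ : Fin M → ℝ) : F :=
  lineDeriv ℝ f θ (Pi.single μ 1)

section Haar

variable (F : Type*) [NormedAddCommGroup F] [InnerProductSpace ℂ F] [FiniteDimensional ℂ F]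
  [CompleteSpace F]

instance compactSpace_unitary_clm : CompactSpace (unitary (F →L[ℂ] F)) := by
  have : ProperSpace (F →L[ℂ] F) := FiniteDimensional.proper ℂ _
  refine isCompact_iff_compactSpace.mp (Metric.isCompact_of_isClosed_isBounded isClosed_unitary ?_)
  refine isBounded_iff_forall_norm_le.mpr ⟨1, fun U hU => ?_⟩
  refine ContinuousLinearMap.opNorm_le_bound _ zero_le_one fun x => ?_
  rw [ContinuousLinearMap.norm_map_of_mem_unitary hU, one_mul]

/-- The normalized Haar measure on the (compact) unitary group of a finite-dimensional complex
Hilbert space. -/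
def unitaryHaar : Measure (unitary (F →L[ℂ] F)) :=
  Measure.haarMeasure (⊤ : TopologicalSpace.PositiveCompacts (unitary (F →L[ℂ] F)))

instance isProbabilityMeasure_unitaryHaar : IsProbabilityMeasure (unitaryHaar F) :=
  ⟨by simpa [unitaryHaar] using
    Measure.haarMeasure_self (K₀ := (⊤ : TopologicalSpace.PositiveCompacts (unitary (F →L[ℂ] F))))⟩

end Haar

section Ensemble

variable {E : Type*} [NormedAddCommGroup E] [InnerProductSpace ℂ E]

/-- The block-diagonal operator `(I - P) + P U P`, where `P` is the orthogonal projector onto the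
subspace `K` and `U` is a unitary operator on `K`. -/
def blockOperator (K : Submodule ℂ E) [CompleteSpace K] (U : K →L[ℂ] K) : E →L[ℂ] E :=
  (1 - K.starProjection) + K.subtypeL ∘L U ∘L K.orthogonalProjectionOnto

theorem blockOperator_mul (K : Submodule ℂ E) [CompleteSpace K] (A B : K →L[ℂ] K) :
    blockOperator K A * blockOperator K B = blockOperator K (A * B) := by
  ext x
  have h (k : K) : K.orthogonalProjectionOnto (k : E) = k :=
    Submodule.orthogonalProjectionOnto_mem_subspace_eq_self k
  have h' (y : E) : K.starProjection y = (K.orthogonalProjectionOnto y : E) := rfl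
  simp only [blockOperator, ContinuousLinearMap.mul_def, ContinuousLinearMap.comp_apply,
    add_apply, sub_apply, one_apply_eq_self,
    Submodule.subtypeL_apply, h', map_add, map_sub, h]
  simp

theorem blockOperator_one (K : Submodule ℂ E) [CompleteSpace K] :
    blockOperator K (1 : K →L[ℂ] K) = 1 := by
  ext x
  simp [blockOperator]

variable [CompleteSpace E]

theorem blockOperator_star (K : Submodule ℂ E) [CompleteSpace K] (A : K →L[ℂ] K) :
    star (blockOperator K A) = blockOperator K (star A) := by
  simp only [blockOperator, star_add, star_sub, star_one, ContinuousLinearMap.star_eq_adjoint,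
    ContinuousLinearMap.adjoint_comp, Submodule.adjoint_subtypeL,
    Submodule.adjoint_orthogonalProjectionOnto, ContinuousLinearMap.comp_assoc]
  congr 2
  exact isSelfAdjoint_starProjection K

theorem blockOperator_mem_unitary (K : Submodule ℂ E) [CompleteSpace K]
    (U : unitary (K →L[ℂ] K)) :
    blockOperator K (U : K →L[ℂ] K) ∈ unitary (E →L[ℂ] E) := by
  rw [Unitary.mem_iff, blockOperator_star, blockOperator_mul, blockOperator_mul,
    Unitary.star_mul_self_of_mem U.2, Unitary.mul_star_self_of_mem U.2, blockOperator_one]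
  exact ⟨rfl, rfl⟩

/-- The unitary operator `(I - P) + P U P` on the whole space. -/
def blockUnitary (K : Submodule ℂ E) [CompleteSpace K] (U : unitary (K →L[ℂ] K)) :
    unitary (E →L[ℂ] E) :=
  ⟨blockOperator K (U : K →L[ℂ] K), blockOperator_mem_unitary K U⟩

theorem continuous_blockUnitary (K : Submodule ℂ E) [CompleteSpace K] :
    Continuous (blockUnitary K) := by
  refine Continuous.subtype_mk ?_ _
  unfold blockOperator
  fun_prop

variable [FiniteDimensional ℂ E]

/-- The law of the random unitary `V = (I - P) + P U P` where `P` is the projector onto the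
orthogonal complement of `ψ` and `U` is Haar-random on the unitary group of that complement. -/
def stateEnsemble (ψ : E) : Measure (unitary (E →L[ℂ] E)) :=
  (unitaryHaar ((ℂ ∙ ψ)ᗮ : Submodule ℂ E)).map (blockUnitary (ℂ ∙ ψ)ᗮ)

instance isProbabilityMeasure_stateEnsemble (ψ : E) : IsProbabilityMeasure (stateEnsemble ψ) :=
  Measure.isProbabilityMeasure_map (continuous_blockUnitary _).measurable.aemeasurable

end Ensemble

/-- A parameterized quantum circuit with `M` trainable parameters: the `μ`-th gate is
`exp(-i θ_μ Ω_μ)` with Hermitian generator `Ω_μ`, preceded by a fixed (non-parameterized) unitary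
gate `W_μ`, and the circuit is applied to a fixed input state. -/
structure QNN (E : Type*) [NormedAddCommGroup E] [InnerProductSpace ℂ E] [CompleteSpace E]
    (M : ℕ) where
  /-- the generators `Ω_μ` -/
  generator : Fin M → (E →L[ℂ] E)
  isSelfAdjoint_generator : ∀ μ, IsSelfAdjoint (generator μ)
  /-- the non-parameterized gates `W_μ` -/
  fixedGate : Fin M → unitary (E →L[ℂ] E)
  /-- the input state -/
  input : E
  norm_input : ‖input‖ = 1

namespace QNN

variable {E : Type*} [NormedAddCommGroup E] [InnerProductSpace ℂ E] [CompleteSpace E] {M : ℕ}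

/-- The circuit `U(θ) = U_M(θ_M) W_M ⋯ U_1(θ_1) W_1`, with `U_μ(t) = exp(-i t Ω_μ)`. -/
def circuit (Q : QNN E M) (θ : Fin M → ℝ) : E →L[ℂ] E :=
  (List.ofFn fun μ : Fin M =>
    NormedSpace.exp ((-Complex.I * (θ μ : ℂ)) • Q.generator μ) *
      (Q.fixedGate μ : E →L[ℂ] E)).reverse.prod

/-- The output state `ψ(θ) = U(θ) |input⟩`. -/
def output (Q : QNN E M) (θ : Fin M → ℝ) : E := Q.circuit θ Q.input

/-- The energy loss `⟨ψ(θ)|H|ψ(θ)⟩` for the observable `H`. -/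
def loss (Q : QNN E M) (H : E →L[ℂ] E) (θ : Fin M → ℝ) : ℝ := expval (Q.output θ) H

/-- The entry `2 Re[⟨∂_μ ψ|∂_ν ψ⟩ - ⟨∂_μ ψ|ψ⟩⟨ψ|∂_ν ψ⟩]` of the quantum Fisher information matrix
at `θ`. -/
def qfi (Q : QNN E M) (θ : Fin M → ℝ) : Matrix (Fin M) (Fin M) ℝ := fun μ ν =>
  2 * (inner ℂ (partialDeriv μ Q.output θ) (partialDeriv ν Q.output θ) -
    inner ℂ (partialDeriv μ Q.output θ) (Q.output θ) *
      inner ℂ (Q.output θ) (partialDeriv ν Q.output θ)).re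

/-- The component `∂_μ 𝓛_V (θ)` of the gradient of `𝓛_V(θ) = ⟨ψ(θ)|V† H V|ψ(θ)⟩`. -/
def lossGrad (Q : QNN E M) (H : E →L[ℂ] E) (θ : Fin M → ℝ) (μ : Fin M)
    (V : unitary (E →L[ℂ] E)) : ℝ :=
  partialDeriv μ (Q.loss (star (V : E →L[ℂ] E) * H * (V : E →L[ℂ] E))) θ

/-- The entry `∂_μ ∂_ν 𝓛_V (θ)` of the Hessian matrix of `𝓛_V(θ) = ⟨ψ(θ)|V† H V|ψ(θ)⟩`. -/
def lossHess (Q : QNN E M) (H : E →L[ℂ] E) (θ : Fin M → ℝ) (μ ν : Fin M)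
    (V : unitary (E →L[ℂ] E)) : ℝ :=
  partialDeriv μ (partialDeriv ν (Q.loss (star (V : E →L[ℂ] E) * H * (V : E →L[ℂ] E)))) θ

end QNN

end

/-! Write `ψ = ψ(θ)`, `P` for the projector onto `ψᗮ`, `n = d - 1`, and `t_μ = P ∂_μ ψ`.
Differentiating `⟨ψ, A ψ⟩` with `A = V† H V` gives matrix elements of `A` between `ψ` and its first
and second derivatives. Since `V` fixes `ψ` and acts as `U` on `ψᗮ`, splitting every vector along
`ψ` and `ψᗮ` turns each such element into a constant, a term `Re ⟨U h, P H ψ⟩` linear in `U`, and a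
term `Re ⟨U u, (P H P) U v⟩` quadratic in `U` (`re_inner_blockOperator`).

Normalization of `ψ` kills the constant in the gradient, leaving `2 Re ⟨U t_μ, P H ψ⟩`, and makes
the constant in the Hessian equal to `-F_μν L`. The Fisher matrix is twice the real Gram matrix of
the `t_μ`, and `‖P H ψ‖²` is the energy variance `⟨H²⟩ - ⟨H⟩²`.

What remains are low Haar moments on `ψᗮ`, obtained from symmetry alone. Left invariance and
transitivity on spheres show that moments of `|⟨f, U z⟩|` depend on `f` only through its norm.
Summing over an orthonormal basis then fixes second moments, the symmetries `U ↦ -U` and `U ↦ iU`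
handle the linear term, and a four-phase identity together with `‖U z‖ = ‖z‖` gives the fourth
moments. Diagonalizing `P H P` and polarizing gives the mean of the quadratic term, `tr(P H P) Re
⟨u, v⟩ / n`, and a variance bound of order `tr((P H P)²) / (n (n + 1))`.

The Hessian bound follows from `Var(X + Y) ≤ 2 Var X + 2 Var Y`, with norms of the derivatives of
`ψ` controlled by `‖Ω_μ‖` because all other factors of the circuit are unitary. -/

noncomputable section

/-! ### Ordered products of gates and derivatives of matrix elements -/

/-- The product `m (n-1) * ⋯ * m 0` as a continuous multilinear map. -/
def reverseProd (n : ℕ) (A : Type*) [NormedRing A] [NormedAlgebra ℝ A] :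
    ContinuousMultilinearMap ℝ (fun _ : Fin n => A) A :=
  (ContinuousMultilinearMap.mkPiAlgebraFin ℝ n A).domDomCongr Fin.revPerm

theorem reverseProd_apply {n : ℕ} {A : Type*} [NormedRing A] [NormedAlgebra ℝ A] (m : Fin n → A) :
    reverseProd n A m = (List.ofFn m).reverse.prod := by
  have h : (List.ofFn m).reverse = List.ofFn fun i => m (Fin.revPerm i) := by
    refine List.ext_getElem (by simp) fun i h₁ h₂ => ?_
    simp only [List.getElem_reverse, List.getElem_ofFn, Fin.revPerm_apply]
    congr 1
    ext
    simp [Fin.rev]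
    omega
  rw [h]
  simp [reverseProd]

/-- Assuming only `‖1‖ ≤ 1` covers the empty product without requiring the space acted on to be
nontrivial. -/
theorem norm_reverseProd_le {n : ℕ} {A : Type*} [NormedRing A] [NormedAlgebra ℝ A]
    (h1 : ‖(1 : A)‖ ≤ 1) (m : Fin n → A) : ‖reverseProd n A m‖ ≤ ∏ i, ‖m i‖ := by
  have key : ∀ l : List A, ‖l.prod‖ ≤ (l.map norm).prod := by
    intro l
    induction l with
    | nil => simpa using h1
    | cons a l ih =>
      simp only [List.prod_cons, List.map_cons]
      exact (norm_mul_le _ _).trans (by gcongr)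
  rw [reverseProd_apply]
  refine (key _).trans_eq ?_
  rw [List.map_reverse, List.prod_reverse, List.map_ofFn, List.prod_ofFn]
  rfl

theorem hasLineDerivAt_re_inner {E : Type*} [NormedAddCommGroup E]
    [InnerProductSpace ℂ E] {M : ℕ} {f g : (Fin M → ℝ) → E} {f' g' : E} {θ v : Fin M → ℝ}
    (A : E →L[ℂ] E) (hf : HasLineDerivAt ℝ f f' θ v) (hg : HasLineDerivAt ℝ g g' θ v) :
    HasLineDerivAt ℝ (fun θ => (inner ℂ (f θ) (A (g θ))).re)
      ((inner ℂ (f θ) (A g')).re + (inner ℂ f' (A (g θ))).re) θ v := by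
  have hA : HasDerivAt (fun t : ℝ => A (g (θ + t • v))) (A g') 0 :=
    ((A.restrictScalars ℝ).hasFDerivAt).comp_hasDerivAt 0 hg
  have h := Complex.reCLM.hasFDerivAt.comp_hasDerivAt 0 (HasDerivAt.inner ℂ hf hA)
  simpa [HasLineDerivAt, Function.comp_def] using h

/-! ### Derivatives of the output state and of the loss -/

namespace QNN

variable {E : Type*} [NormedAddCommGroup E] [InnerProductSpace ℂ E] [CompleteSpace E] {M : ℕ}

/-- The `k`-th derivative of the gate `exp(-i θ_i Ω_i) W_i` with respect to `θ_i`. -/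
def gateDeriv (Q : QNN E M) (k : Fin M → ℕ) (θ : Fin M → ℝ) (i : Fin M) : E →L[ℂ] E :=
  (-Complex.I • Q.generator i) ^ k i *
    NormedSpace.exp ((-Complex.I * (θ i : ℂ)) • Q.generator i) * (Q.fixedGate i : E →L[ℂ] E)

/-- The partial derivative of the output state with multi-index `k`. -/
def outputDeriv (Q : QNN E M) (k : Fin M → ℕ) (θ : Fin M → ℝ) : E :=
  reverseProd M (E →L[ℂ] E) (Q.gateDeriv k θ) Q.input

theorem outputDeriv_zero (Q : QNN E M) : Q.outputDeriv 0 = Q.output := by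
  ext θ
  simp only [outputDeriv, output, circuit, reverseProd_apply]
  congr 4

theorem exp_mem_unitary (Q : QNN E M) (i : Fin M) (t : ℝ) :
    NormedSpace.exp ((-Complex.I * (t : ℂ)) • Q.generator i) ∈ unitary (E →L[ℂ] E) := by
  let _ : NormedAlgebra ℚ (E →L[ℂ] E) := .restrictScalars ℚ ℂ (E →L[ℂ] E)
  refine NormedSpace.exp_mem_unitary_of_mem_skewAdjoint ?_
  rw [skewAdjoint.mem_iff, star_smul, (Q.isSelfAdjoint_generator i).star_eq, ← neg_smul]
  simp

theorem norm_gateDeriv_le (Q : QNN E M) (k : Fin M → ℕ) (θ : Fin M → ℝ) (i : Fin M) :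
    ‖Q.gateDeriv k θ i‖ ≤ ‖Q.generator i‖ ^ k i := by
  refine ContinuousLinearMap.opNorm_le_bound _ (by positivity) fun x => ?_
  have hp : ∀ (m : ℕ) (y : E), ‖((-Complex.I • Q.generator i) ^ m) y‖ ≤
      ‖Q.generator i‖ ^ m * ‖y‖ := by
    intro m y
    induction m with
    | zero => simp
    | succ m ih =>
      rw [pow_succ', mul_apply_eq_comp]
      refine (ContinuousLinearMap.le_opNorm _ _).trans ?_
      rw [norm_smul, norm_neg, Complex.norm_I, one_mul, pow_succ', mul_assoc]
      gcongr
  simp only [gateDeriv, mul_apply_eq_comp]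
  refine (hp _ _).trans_eq ?_
  rw [ContinuousLinearMap.norm_map_of_mem_unitary (Q.exp_mem_unitary i _), Unitary.norm_map]

/-- Each derivative inserts one more factor `-i Ω_i` beside unitary factors of norm at most one, so
only the generators contribute. -/
theorem norm_outputDeriv_le (Q : QNN E M) (k : Fin M → ℕ) (θ : Fin M → ℝ) :
    ‖Q.outputDeriv k θ‖ ≤ ∏ i, ‖Q.generator i‖ ^ k i := by
  refine (ContinuousLinearMap.le_opNorm _ _).trans ?_
  rw [Q.norm_input, mul_one]
  refine (norm_reverseProd_le ContinuousLinearMap.norm_id_le _).trans ?_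
  exact Finset.prod_le_prod (fun _ _ => norm_nonneg _) fun i _ => Q.norm_gateDeriv_le k θ i

theorem norm_output (Q : QNN E M) (θ : Fin M → ℝ) : ‖Q.output θ‖ = 1 := by
  have h : Q.circuit θ ∈ unitary (E →L[ℂ] E) := by
    refine list_prod_mem fun A hA => ?_
    rw [List.mem_reverse, List.mem_ofFn] at hA
    obtain ⟨i, rfl⟩ := hA
    exact mul_mem (Q.exp_mem_unitary i _) (Q.fixedGate i).2
  rw [output, ContinuousLinearMap.norm_map_of_mem_unitary h, Q.norm_input]

theorem hasDerivAt_gate (Q : QNN E M) (i : Fin M) (n : ℕ) (t : ℝ) :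
    HasDerivAt (fun s : ℝ => (-Complex.I • Q.generator i) ^ n *
        NormedSpace.exp ((-Complex.I * (s : ℂ)) • Q.generator i) * (Q.fixedGate i : E →L[ℂ] E))
      ((-Complex.I • Q.generator i) ^ (n + 1) *
        NormedSpace.exp ((-Complex.I * (t : ℂ)) • Q.generator i) *
          (Q.fixedGate i : E →L[ℂ] E)) t := by
  have h := hasDerivAt_exp_smul_const' (𝕂 := ℝ) (-Complex.I • Q.generator i) t
  have he : ∀ s : ℝ, s • (-Complex.I • Q.generator i) =
      (-Complex.I * (s : ℂ)) • Q.generator i := fun s => by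
    rw [← Complex.coe_smul, smul_smul, mul_comm]
  simp only [he] at h
  have h' := (h.const_mul ((-Complex.I • Q.generator i) ^ n)).mul_const
    (Q.fixedGate i : E →L[ℂ] E)
  rwa [← mul_assoc, ← pow_succ] at h'

/-- Moving along a coordinate axis changes one slot of a multilinear product, hence differentiation
just raises one exponent. The multi-index form treats repeated and mixed second derivatives alike.
-/
theorem hasLineDerivAt_outputDeriv (Q : QNN E M) (k : Fin M → ℕ) (μ : Fin M) (θ : Fin M → ℝ) :
    HasLineDerivAt ℝ (Q.outputDeriv k) (Q.outputDeriv (k + Pi.single μ 1) θ) θ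
      (Pi.single μ 1) := by
  have h1 : ∀ t : ℝ, Q.gateDeriv k (θ + t • Pi.single μ 1) =
      Function.update (Q.gateDeriv k θ) μ ((-Complex.I • Q.generator μ) ^ k μ *
        NormedSpace.exp ((-Complex.I * ((θ μ + t : ℝ) : ℂ)) • Q.generator μ) *
          (Q.fixedGate μ : E →L[ℂ] E)) := by
    intro t
    ext1 i
    rcases eq_or_ne i μ with rfl | hi
    · simp [gateDeriv]
    · simp [gateDeriv, hi]
  have h2 : Q.gateDeriv (k + Pi.single μ 1) θ =
      Function.update (Q.gateDeriv k θ) μ ((-Complex.I • Q.generator μ) ^ (k μ + 1) *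
        NormedSpace.exp ((-Complex.I * (θ μ : ℂ)) • Q.generator μ) *
          (Q.fixedGate μ : E →L[ℂ] E)) := by
    ext1 i
    rcases eq_or_ne i μ with rfl | hi
    · simp [gateDeriv]
    · simp [gateDeriv, hi]
  have hg := (Q.hasDerivAt_gate μ (k μ) (θ μ + 0)).comp_const_add (θ μ) 0
  rw [add_zero] at hg
  have hL := (((reverseProd M (E →L[ℂ] E)).toContinuousLinearMap
    (Q.gateDeriv k θ) μ).hasFDerivAt).comp_hasDerivAt 0 hg
  have hA := (((ContinuousLinearMap.apply ℂ E Q.input : (E →L[ℂ] E) →L[ℂ] E).restrictScalars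
    ℝ).hasFDerivAt).comp_hasDerivAt 0 hL
  simp only [HasLineDerivAt, outputDeriv, h1, h2]
  exact hA

theorem contDiff_output (Q : QNN E M) : ContDiff ℝ ((⊤ : ℕ∞) : WithTop ℕ∞) Q.output := by
  have he : ContDiff ℝ ((⊤ : ℕ∞) : WithTop ℕ∞) (NormedSpace.exp : (E →L[ℂ] E) → (E →L[ℂ] E)) :=
    contDiff_iff_contDiffAt.2 fun x => (NormedSpace.exp_analytic (𝕂 := ℝ) x).contDiffAt
  have hg : ContDiff ℝ ((⊤ : ℕ∞) : WithTop ℕ∞) fun θ => Q.gateDeriv 0 θ := by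
    refine contDiff_pi.2 fun i => ?_
    have h : ContDiff ℝ ((⊤ : ℕ∞) : WithTop ℕ∞) fun θ : Fin M → ℝ =>
        (-Complex.I * (θ i : ℂ)) • Q.generator i := by
      have h' : ContDiff ℝ ((⊤ : ℕ∞) : WithTop ℕ∞) fun θ : Fin M → ℝ =>
          θ i • (-Complex.I • Q.generator i) := (contDiff_apply ℝ ℝ i).smul contDiff_const
      convert! h' using 2 with θ
      rw [← Complex.coe_smul, smul_smul, mul_comm]
    exact ContDiff.mul (ContDiff.mul contDiff_const (he.comp h)) contDiff_const
  rw [← Q.outputDeriv_zero]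
  exact ((ContinuousLinearMap.apply ℂ E Q.input : (E →L[ℂ] E) →L[ℂ] E).restrictScalars
    ℝ).contDiff.comp
    ((reverseProd M (E →L[ℂ] E)).contDiff.comp hg)

theorem contDiff_loss (Q : QNN E M) (A : E →L[ℂ] E) :
    ContDiff ℝ ((⊤ : ℕ∞) : WithTop ℕ∞) (Q.loss A) := by
  have h : ContDiff ℝ ((⊤ : ℕ∞) : WithTop ℕ∞) fun θ => inner ℂ (Q.output θ) (A (Q.output θ)) :=
    Q.contDiff_output.inner ℂ ((A.restrictScalars ℝ).contDiff.comp Q.contDiff_output)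
  exact Complex.reCLM.contDiff.comp h

theorem re_inner_apply_comm {A : E →L[ℂ] E} (hA : IsSelfAdjoint A) (x y : E) :
    (inner ℂ x (A y)).re = (inner ℂ y (A x)).re := by
  rw [← hA.isSymmetric.apply_clm x y, ← inner_conj_symm, Complex.conj_re]

/-- The state `∂_μ ψ`. -/
def outputFst (Q : QNN E M) (θ : Fin M → ℝ) (μ : Fin M) : E := Q.outputDeriv (Pi.single μ 1) θ

/-- The state `∂_μ ∂_ν ψ`. -/
def outputSnd (Q : QNN E M) (θ : Fin M → ℝ) (μ ν : Fin M) : E :=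
  Q.outputDeriv (Pi.single ν 1 + Pi.single μ 1) θ

theorem hasLineDerivAt_output (Q : QNN E M) (θ : Fin M → ℝ) (μ : Fin M) :
    HasLineDerivAt ℝ Q.output (Q.outputFst θ μ) θ (Pi.single μ 1) := by
  simpa [outputDeriv_zero, outputFst] using Q.hasLineDerivAt_outputDeriv 0 μ θ

theorem partialDeriv_output (Q : QNN E M) (θ : Fin M → ℝ) (μ : Fin M) :
    partialDeriv μ Q.output θ = Q.outputFst θ μ :=
  (Q.hasLineDerivAt_output θ μ).lineDeriv

theorem hasLineDerivAt_outputFst (Q : QNN E M) (θ : Fin M → ℝ) (μ ν : Fin M) :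
    HasLineDerivAt ℝ (fun θ => Q.outputFst θ ν) (Q.outputSnd θ μ ν) θ (Pi.single μ 1) :=
  Q.hasLineDerivAt_outputDeriv (Pi.single ν 1) μ θ

theorem norm_outputFst_le (Q : QNN E M) (θ : Fin M → ℝ) (μ : Fin M) :
    ‖Q.outputFst θ μ‖ ≤ ‖Q.generator μ‖ := by
  refine (Q.norm_outputDeriv_le _ θ).trans_eq ?_
  rw [Finset.prod_eq_single μ] <;> simp +contextual

theorem norm_outputSnd_le (Q : QNN E M) (θ : Fin M → ℝ) (μ ν : Fin M) :
    ‖Q.outputSnd θ μ ν‖ ≤ ‖Q.generator μ‖ * ‖Q.generator ν‖ := by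
  refine (Q.norm_outputDeriv_le _ θ).trans_eq ?_
  simp only [Pi.add_apply, pow_add, Finset.prod_mul_distrib]
  rw [Finset.prod_eq_single ν, Finset.prod_eq_single μ, mul_comm] <;> simp +contextual

theorem partialDeriv_loss (Q : QNN E M) {A : E →L[ℂ] E} (hA : IsSelfAdjoint A) (μ : Fin M) :
    partialDeriv μ (Q.loss A) =
      fun θ => 2 * (inner ℂ (Q.outputFst θ μ) (A (Q.output θ))).re := by
  ext θ
  have h := (hasLineDerivAt_re_inner A (Q.hasLineDerivAt_output θ μ)
    (Q.hasLineDerivAt_output θ μ)).lineDeriv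
  refine h.trans ?_
  rw [re_inner_apply_comm hA, two_mul]

theorem partialDeriv_partialDeriv_loss (Q : QNN E M) {A : E →L[ℂ] E} (hA : IsSelfAdjoint A)
    (θ : Fin M → ℝ) (μ ν : Fin M) :
    partialDeriv μ (partialDeriv ν (Q.loss A)) θ =
      2 * (inner ℂ (Q.outputSnd θ μ ν) (A (Q.output θ))).re +
        2 * (inner ℂ (Q.outputFst θ μ) (A (Q.outputFst θ ν))).re := by
  rw [Q.partialDeriv_loss hA]
  have h := hasLineDerivAt_re_inner A (Q.hasLineDerivAt_outputFst θ μ ν)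
    (Q.hasLineDerivAt_output θ μ)
  have h' : HasLineDerivAt ℝ
      (fun θ => 2 * (inner ℂ (Q.outputFst θ ν) (A (Q.output θ))).re) _ θ (Pi.single μ 1) :=
    HasDerivAt.const_mul 2 h
  refine h'.lineDeriv.trans ?_
  rw [re_inner_apply_comm hA (Q.outputFst θ ν)]
  ring

/-- Normalization phrased as a constant loss: the derivative formulas for the loss, taken at the
identity observable, then yield the first- and second-order consequences of `‖ψ‖ = 1`. -/
theorem loss_one (Q : QNN E M) : Q.loss 1 = fun _ => 1 := by
  ext θ
  simp [loss, expval, Q.norm_output]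

theorem re_inner_outputFst_output (Q : QNN E M) (θ : Fin M → ℝ) (μ : Fin M) :
    (inner ℂ (Q.outputFst θ μ) (Q.output θ)).re = 0 := by
  have h := congrFun (Q.partialDeriv_loss (A := 1) (.one _) μ) θ
  rw [loss_one] at h
  simpa [partialDeriv, lineDeriv] using h

theorem re_inner_outputSnd_output (Q : QNN E M) (θ : Fin M → ℝ) (μ ν : Fin M) :
    (inner ℂ (Q.outputSnd θ μ ν) (Q.output θ)).re =
      -(inner ℂ (Q.outputFst θ μ) (Q.outputFst θ ν)).re := by
  have h := Q.partialDeriv_partialDeriv_loss (A := 1) (.one _) θ μ ν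
  have h0 : partialDeriv ν (Q.loss 1) = fun _ => 0 := by
    rw [loss_one]; ext; simp [partialDeriv, lineDeriv]
  rw [h0] at h
  simp [partialDeriv, lineDeriv] at h
  linarith

end QNN

theorem re_inner_apply_eq_sum {F : Type*} [NormedAddCommGroup F]
    [InnerProductSpace ℂ F] [CompleteSpace F] {n : ℕ} {G : F →L[ℂ] F} {b : OrthonormalBasis (Fin n) ℂ F}
    (hG : IsSelfAdjoint G) {a : Fin n → ℝ} (hb : ∀ i, G (b i) = (a i : ℂ) • b i) (w : F) :
    (inner ℂ w (G w)).re = ∑ i, a i * ‖inner ℂ (b i) w‖ ^ 2 := by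
  rw [← b.sum_inner_mul_inner, Complex.re_sum]
  refine Finset.sum_congr rfl fun i _ => ?_
  rw [← hG.isSymmetric.apply_clm (b i) w, hb, inner_smul_left, ← inner_conj_symm w,
    mul_left_comm, Complex.conj_mul']
  simp [← Complex.ofReal_pow]

/-! ### Moments of the Haar measure up to degree four -/

section HaarMoments

variable {F : Type*} [NormedAddCommGroup F] [InnerProductSpace ℂ F] [FiniteDimensional ℂ F]
  [CompleteSpace F]

instance isMulLeftInvariant_unitaryHaar : (unitaryHaar F).IsMulLeftInvariant := by
  unfold unitaryHaar; infer_instance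

theorem memLp_two_of_continuous {X : Type*} [TopologicalSpace X] [CompactSpace X]
    [MeasurableSpace X] [OpensMeasurableSpace X] {m : Measure X} [IsFiniteMeasure m] {f : X → ℝ}
    (hf : Continuous f) : MemLp f 2 m :=
  hf.memLp_of_hasCompactSupport (.of_compactSpace f)

theorem integrable_of_continuous {X : Type*} [TopologicalSpace X] [CompactSpace X]
    [MeasurableSpace X] [OpensMeasurableSpace X] {m : Measure X} [IsFiniteMeasure m] {f : X → ℝ}
    (hf : Continuous f) : Integrable f m :=
  hf.integrable_of_hasCompactSupport (.of_compactSpace f)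

/-- The unitary group acts transitively on spheres. -/
theorem exists_unitary_apply_eq {f g : F} (h : ‖f‖ = ‖g‖) :
    ∃ W : unitary (F →L[ℂ] F), (W : F →L[ℂ] F) f = g := by
  rcases eq_or_ne f 0 with rfl | hf
  · exact ⟨1, by simpa [eq_comm] using h⟩
  have : Nontrivial F := ⟨f, 0, hf⟩
  have : NeZero (Module.finrank ℂ F) := ⟨Module.finrank_pos.ne'⟩
  have ext : ∀ u : F, ‖u‖ = 1 →
      ∃ b : OrthonormalBasis (Fin (Module.finrank ℂ F)) ℂ F, b 0 = u := by
    intro u hu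
    have ho : Orthonormal ℂ (Set.domRestrict {0} fun _ : Fin (Module.finrank ℂ F) => u) := by
      refine ⟨fun i => hu, fun i j hij => absurd (Subsingleton.elim i j) hij⟩
    obtain ⟨b, hb⟩ := ho.exists_orthonormalBasis_extension_of_card_eq (by simp)
    exact ⟨b, hb 0 rfl⟩
  have hf' : (‖f‖ : ℂ) ≠ 0 := by simpa using hf
  have hg' : (‖g‖ : ℂ) ≠ 0 := by rwa [← h]
  obtain ⟨b, hb⟩ := ext (((‖f‖ : ℂ)⁻¹) • f) (by rw [norm_smul]; simp [hf])
  obtain ⟨c, hc⟩ := ext (((‖g‖ : ℂ)⁻¹) • g) (by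
    rw [norm_smul]; simp [(norm_ne_zero_iff.1 (h ▸ norm_ne_zero_iff.2 hf))])
  refine ⟨Unitary.linearIsometryEquiv.symm (b.equiv c (Equiv.refl _)), ?_⟩
  have hbc : b.equiv c (Equiv.refl _) (b 0) = c 0 := by simp
  rw [hb, hc, map_smul] at hbc
  have := congrArg (fun v => (‖f‖ : ℂ) • v) hbc
  simp only [smul_smul, mul_inv_cancel₀ hf', one_smul] at this
  rw [h, mul_inv_cancel₀ hg', one_smul] at this
  simpa using this

/-- A unitary carrying `f` to `g` can be absorbed into `U` by left invariance. -/
theorem integral_norm_inner_pow_congr {f g : F} (h : ‖f‖ = ‖g‖) (z : F) (k : ℕ) :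
    ∫ U, ‖inner ℂ f ((U : F →L[ℂ] F) z)‖ ^ k ∂(unitaryHaar F) =
      ∫ U, ‖inner ℂ g ((U : F →L[ℂ] F) z)‖ ^ k ∂(unitaryHaar F) := by
  obtain ⟨W, rfl⟩ := exists_unitary_apply_eq h
  rw [← integral_mul_left_eq_self
    (fun U : unitary (F →L[ℂ] F) => ‖inner ℂ ((W : F →L[ℂ] F) f) ((U : F →L[ℂ] F) z)‖ ^ k) W]
  simp [Unitary.inner_map_map]

/-- All basis vectors give the same moment, and the moments add up to `‖U z‖² = ‖z‖²`. -/
theorem integral_norm_inner_sq_basis {n : ℕ} (b : OrthonormalBasis (Fin n) ℂ F) (i : Fin n)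
    (z : F) : ∫ U, ‖inner ℂ (b i) ((U : F →L[ℂ] F) z)‖ ^ 2 ∂(unitaryHaar F) = ‖z‖ ^ 2 / n := by
  have hn : (n : ℝ) ≠ 0 := by have := i.pos; positivity
  have h : ∑ j, ∫ U, ‖inner ℂ (b j) ((U : F →L[ℂ] F) z)‖ ^ 2 ∂(unitaryHaar F) = ‖z‖ ^ 2 := by
    rw [← integral_finsetSum _ fun j _ => integrable_of_continuous (by fun_prop)]
    simp [b.sum_sq_norm_inner_right, Unitary.norm_map]
  rw [eq_div_iff hn, ← h, Finset.sum_congr rfl fun j _ =>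
    integral_norm_inner_pow_congr (f := b j) (g := b i) (by simp) z 2]
  simp [mul_comm]

theorem integral_norm_inner_sq (f z : F) :
    ∫ U, ‖inner ℂ f ((U : F →L[ℂ] F) z)‖ ^ 2 ∂(unitaryHaar F) =
      ‖f‖ ^ 2 * ‖z‖ ^ 2 / Module.finrank ℂ F := by
  rcases eq_or_ne f 0 with rfl | hf
  · simp
  have : Nontrivial F := ⟨f, 0, hf⟩
  have : NeZero (Module.finrank ℂ F) := ⟨Module.finrank_pos.ne'⟩
  have b := stdOrthonormalBasis ℂ F
  rw [integral_norm_inner_pow_congr (f := f) (g := (‖f‖ : ℂ) • b 0) (by simp [norm_smul])]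
  simp only [inner_smul_left, norm_mul, mul_pow, integral_const_mul,
    integral_norm_inner_sq_basis b 0 z]
  simp
  ring

/-- The integrand is odd under `U ↦ -U`, which preserves Haar measure. -/
theorem integral_re_inner (f z : F) :
    ∫ U, (inner ℂ ((U : F →L[ℂ] F) z) f).re ∂(unitaryHaar F) = 0 := by
  have h := integral_mul_left_eq_self (μ := unitaryHaar F)
    (fun U : unitary (F →L[ℂ] F) => (inner ℂ ((U : F →L[ℂ] F) z) f).re) (-1)
  simp [Unitary.coe_neg, integral_neg] at h
  linarith

/-- The unitary scalar `i`. -/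
def unitaryI : unitary (F →L[ℂ] F) :=
  ⟨Complex.I • 1, by
    rw [Unitary.mem_iff]
    simp [star_smul, smul_smul]⟩

/-- Replacing `U` by `iU` exchanges real and imaginary parts up to sign, so each carries half of the
second moment of the modulus. -/
theorem integral_re_inner_sq (f z : F) :
    ∫ U, (inner ℂ ((U : F →L[ℂ] F) z) f).re ^ 2 ∂(unitaryHaar F) =
      ‖f‖ ^ 2 * ‖z‖ ^ 2 / (2 * Module.finrank ℂ F) := by
  have h := integral_mul_left_eq_self (μ := unitaryHaar F)
    (fun U : unitary (F →L[ℂ] F) => (inner ℂ ((U : F →L[ℂ] F) z) f).re ^ 2) unitaryI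
  have h' : ∀ U : unitary (F →L[ℂ] F), ‖inner ℂ f ((U : F →L[ℂ] F) z)‖ ^ 2 =
      (inner ℂ ((U : F →L[ℂ] F) z) f).re ^ 2 +
        (inner ℂ (((unitaryI * U : unitary (F →L[ℂ] F)) : F →L[ℂ] F) z) f).re ^ 2 := by
    intro U
    rw [← inner_conj_symm, RCLike.norm_conj, Complex.sq_norm, Complex.normSq_apply]
    simp [unitaryI]
    ring
  have h2 := integral_norm_inner_sq f z
  rw [integral_congr_ae (ae_of_all _ h'), integral_add (integrable_of_continuous (by fun_prop))
    (integrable_of_continuous (by fun_prop)), h] at h2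
  have h3 : ‖f‖ ^ 2 * ‖z‖ ^ 2 / (2 * Module.finrank ℂ F) =
    (‖f‖ ^ 2 * ‖z‖ ^ 2 / Module.finrank ℂ F) / 2 := by rw [div_div, mul_comm 2]
  rw [h3, ← h2]
  ring

theorem variance_two_mul_re_inner (f z : F) :
    ProbabilityTheory.variance
      (fun U : unitary (F →L[ℂ] F) => 2 * (inner ℂ ((U : F →L[ℂ] F) z) f).re) (unitaryHaar F) =
      2 * ‖f‖ ^ 2 * ‖z‖ ^ 2 / Module.finrank ℂ F := by
  rw [ProbabilityTheory.variance_const_mul,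
    ProbabilityTheory.variance_eq_sub (memLp_two_of_continuous (by fun_prop))]
  simp only [integral_re_inner, Pi.pow_apply, integral_re_inner_sq]
  ring

/-- Averaging over the phases `±1, ±i` removes the phase-dependent terms; this expresses `‖u‖² ‖v‖²`
through fourth powers alone. -/
theorem norm_add_pow_four_phases (u v : ℂ) :
    ‖u + v‖ ^ 4 + ‖u - v‖ ^ 4 + ‖u + Complex.I * v‖ ^ 4 + ‖u - Complex.I * v‖ ^ 4 =
      4 * (‖u‖ ^ 4 + ‖v‖ ^ 4 + 4 * (‖u‖ ^ 2 * ‖v‖ ^ 2)) := by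
  have h : ∀ w : ℂ, ‖w‖ ^ 4 = (w.re * w.re + w.im * w.im) ^ 2 := fun w => by
    rw [← Complex.normSq_apply, ← Complex.sq_norm, ← pow_mul]
  simp only [h, Complex.sq_norm, Complex.normSq_apply]
  simp
  ring

/-- With `c` the common fourth moment of unit vectors, the four vectors `b i + w • b j` have norm
`√2` and fourth moment `4 c`. The phase identity reads `16 c = 4 (2 c + 4 m)`, so the mixed moment
`m` is `c / 2`. -/
theorem integral_mul_norm_inner_sq_basis {n : ℕ} (b : OrthonormalBasis (Fin n) ℂ F)
    (l i j : Fin n) (z : F) :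
    ∫ U, ‖inner ℂ (b i) ((U : F →L[ℂ] F) z)‖ ^ 2 * ‖inner ℂ (b j) ((U : F →L[ℂ] F) z)‖ ^ 2
        ∂(unitaryHaar F) =
      (if i = j then 2 else 1) *
        ((∫ U, ‖inner ℂ (b l) ((U : F →L[ℂ] F) z)‖ ^ 4 ∂(unitaryHaar F)) / 2) := by
  have hl : ∀ i, ∫ U, ‖inner ℂ (b i) ((U : F →L[ℂ] F) z)‖ ^ 4 ∂(unitaryHaar F) =
      ∫ U, ‖inner ℂ (b l) ((U : F →L[ℂ] F) z)‖ ^ 4 ∂(unitaryHaar F) :=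
    fun i => integral_norm_inner_pow_congr (by simp) z 4
  set c := ∫ U, ‖inner ℂ (b l) ((U : F →L[ℂ] F) z)‖ ^ 4 ∂(unitaryHaar F) with hc
  rcases eq_or_ne i j with rfl | hij
  · simp only [← pow_add, if_true, hl]
    ring
  have hphase : ∀ w : ℂ, ‖w‖ = 1 →
      ∫ U, ‖inner ℂ (b i + w • b j) ((U : F →L[ℂ] F) z)‖ ^ 4 ∂(unitaryHaar F) = 4 * c := by
    intro w hw
    have h1 : ‖b i + w • b j‖ ^ 2 = 2 := by
      have h := norm_add_sq (𝕜 := ℂ) (b i) (w • b j)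
      rw [inner_smul_right, b.inner_eq_zero hij, norm_smul, hw] at h
      rw [h]; norm_num
    have h2 : ‖b i + w • b j‖ = ‖((Real.sqrt 2 : ℝ) : ℂ) • b l‖ := by
      rw [norm_smul, b.norm_eq_one, mul_one, Complex.norm_real, Real.norm_of_nonneg (by positivity),
        ← h1, Real.sqrt_sq (norm_nonneg _)]
    rw [integral_norm_inner_pow_congr h2]
    have h3 : (Real.sqrt 2) ^ 4 = 4 := by
      rw [show 4 = 2 * 2 from rfl, pow_mul, Real.sq_sqrt] <;> norm_num
    simp only [inner_smul_left, norm_mul, mul_pow, integral_const_mul, RCLike.norm_conj,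
      Complex.norm_real, Real.norm_of_nonneg (Real.sqrt_nonneg 2), h3, hc]
  -- The inner product is conjugate-linear on the left, so the coefficient `-i` produces the term `u
  -- + i v`.
  have key : ∀ U : unitary (F →L[ℂ] F),
      ‖inner ℂ (b i) ((U : F →L[ℂ] F) z)‖ ^ 2 * ‖inner ℂ (b j) ((U : F →L[ℂ] F) z)‖ ^ 2 =
      (‖inner ℂ (b i + (1 : ℂ) • b j) ((U : F →L[ℂ] F) z)‖ ^ 4 +
        ‖inner ℂ (b i + (-1 : ℂ) • b j) ((U : F →L[ℂ] F) z)‖ ^ 4 +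
        ‖inner ℂ (b i + (-Complex.I) • b j) ((U : F →L[ℂ] F) z)‖ ^ 4 +
        ‖inner ℂ (b i + Complex.I • b j) ((U : F →L[ℂ] F) z)‖ ^ 4 -
        4 * (‖inner ℂ (b i) ((U : F →L[ℂ] F) z)‖ ^ 4 +
          ‖inner ℂ (b j) ((U : F →L[ℂ] F) z)‖ ^ 4)) / 16 := by
    intro U
    have h := norm_add_pow_four_phases (inner ℂ (b i) ((U : F →L[ℂ] F) z))
      (inner ℂ (b j) ((U : F →L[ℂ] F) z))
    simp only [inner_add_left, inner_smul_left, map_neg, map_one, Complex.conj_I, neg_neg, one_mul,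
      neg_mul, ← sub_eq_add_neg]
    linarith
  rw [integral_congr_ae (ae_of_all _ key), integral_div, integral_sub, integral_add, integral_add,
    integral_add, integral_const_mul, integral_add, hphase 1 (by simp), hphase (-1) (by simp),
    hphase (-Complex.I) (by simp), hphase Complex.I (by simp), hl, hl,
    if_neg hij]
  · ring
  all_goals exact integrable_of_continuous (by fun_prop)

theorem integral_sq_sum_norm_inner_sq_basis {n : ℕ} (b : OrthonormalBasis (Fin n) ℂ F)
    (l : Fin n) (a : Fin n → ℝ) (z : F) :
    ∫ U, (∑ i, a i * ‖inner ℂ (b i) ((U : F →L[ℂ] F) z)‖ ^ 2) ^ 2 ∂(unitaryHaar F) =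
      (∑ i, a i ^ 2 + (∑ i, a i) ^ 2) *
        ((∫ U, ‖inner ℂ (b l) ((U : F →L[ℂ] F) z)‖ ^ 4 ∂(unitaryHaar F)) / 2) := by
  have h : ∀ U : unitary (F →L[ℂ] F),
      (∑ i, a i * ‖inner ℂ (b i) ((U : F →L[ℂ] F) z)‖ ^ 2) ^ 2 =
      ∑ i, ∑ j, a i * a j * (‖inner ℂ (b i) ((U : F →L[ℂ] F) z)‖ ^ 2 *
        ‖inner ℂ (b j) ((U : F →L[ℂ] F) z)‖ ^ 2) := fun U => by
    rw [sq, Finset.sum_mul_sum]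
    exact Finset.sum_congr rfl fun i _ => Finset.sum_congr rfl fun j _ => by ring
  rw [integral_congr_ae (ae_of_all _ h),
    integral_finsetSum _ fun i _ => integrable_of_continuous (by fun_prop)]
  have h' : ∀ i, ∫ U, ∑ j, a i * a j * (‖inner ℂ (b i) ((U : F →L[ℂ] F) z)‖ ^ 2 *
      ‖inner ℂ (b j) ((U : F →L[ℂ] F) z)‖ ^ 2) ∂(unitaryHaar F) =
      ∑ j, a i * a j * ((if i = j then 2 else 1) *
        ((∫ U, ‖inner ℂ (b l) ((U : F →L[ℂ] F) z)‖ ^ 4 ∂(unitaryHaar F)) / 2)) := fun i => by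
    rw [integral_finsetSum _ fun j _ => integrable_of_continuous (by fun_prop)]
    simp only [integral_const_mul, integral_mul_norm_inner_sq_basis b l]
  simp only [h']
  rw [add_mul, Finset.sum_mul, sq (∑ i, a i), Finset.sum_mul_sum, Finset.sum_mul,
    ← Finset.sum_add_distrib]
  refine Finset.sum_congr rfl fun i _ => ?_
  have hs : ∀ j, (if i = j then (2 : ℝ) else 1) = 1 + if i = j then 1 else 0 := fun j => by
    split_ifs <;> norm_num
  simp only [hs, add_mul, mul_add, Finset.sum_add_distrib, one_mul, ite_mul, zero_mul, mul_ite,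
    mul_zero, Finset.sum_ite_eq, Finset.mem_univ, if_true, Finset.sum_mul]
  ring

/-- Taking all weights equal to one makes the weighted sum the constant `‖z‖²`, which determines the
unknown moment without evaluating an integral over the sphere. -/
theorem integral_norm_inner_pow_four_basis {n : ℕ} (b : OrthonormalBasis (Fin n) ℂ F)
    (l : Fin n) (z : F) :
    (∫ U, ‖inner ℂ (b l) ((U : F →L[ℂ] F) z)‖ ^ 4 ∂(unitaryHaar F)) / 2 =
      ‖z‖ ^ 4 / (n * (n + 1)) := by
  have hn : 0 < (n : ℝ) := by have := l.pos; positivity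
  have h := integral_sq_sum_norm_inner_sq_basis b l (fun _ => 1) z
  simp only [one_mul, b.sum_sq_norm_inner_right, Unitary.norm_map] at h
  simp at h
  rw [eq_div_iff (by positivity), show ‖z‖ ^ 4 = (‖z‖ ^ 2) ^ 2 by ring, h]
  ring

theorem exists_eigenbasis {G : F →L[ℂ] F} (hG : IsSelfAdjoint G) :
    ∃ (b : OrthonormalBasis (Fin (Module.finrank ℂ F)) ℂ F) (a : Fin (Module.finrank ℂ F) → ℝ),
      (∀ i, G (b i) = (a i : ℂ) • b i) ∧ trRe G = ∑ i, a i ∧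
        trRe (star G * G) = ∑ i, a i ^ 2 := by
  have hs : (G : F →ₗ[ℂ] F).IsSymmetric := hG.isSymmetric
  have hb : ∀ i, G (hs.eigenvectorBasis rfl i) =
    (hs.eigenvalues rfl i : ℂ) • hs.eigenvectorBasis rfl i := hs.apply_eigenvectorBasis rfl
  refine ⟨hs.eigenvectorBasis rfl, hs.eigenvalues rfl, hb, ?_, ?_⟩
  · rw [trRe, LinearMap.trace_eq_sum_inner _ (hs.eigenvectorBasis rfl), Complex.re_sum]
    refine Finset.sum_congr rfl fun i _ => ?_
    rw [ContinuousLinearMap.coe_coe, hb, inner_smul_right]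
    simp
  · rw [trRe, LinearMap.trace_eq_sum_inner _ (hs.eigenvectorBasis rfl), Complex.re_sum]
    refine Finset.sum_congr rfl fun i _ => ?_
    rw [ContinuousLinearMap.coe_coe, hG.star_eq, mul_apply_eq_comp, hb, map_smul, hb, smul_smul,
      inner_smul_right]
    simp [sq]

theorem integral_re_inner_apply_self {G : F →L[ℂ] F} (hG : IsSelfAdjoint G) (z : F) :
    ∫ U, (inner ℂ ((U : F →L[ℂ] F) z) (G ((U : F →L[ℂ] F) z))).re ∂(unitaryHaar F) =
      trRe G * ‖z‖ ^ 2 / Module.finrank ℂ F := by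
  obtain ⟨b, a, hb, htr, -⟩ := exists_eigenbasis hG
  simp only [re_inner_apply_eq_sum hG hb]
  rw [integral_finsetSum _ fun i _ => integrable_of_continuous (by fun_prop)]
  simp only [integral_const_mul, integral_norm_inner_sq_basis]
  rw [← Finset.sum_mul, htr, mul_div_assoc]

theorem re_inner_apply_polarization {F : Type*} [NormedAddCommGroup F] [InnerProductSpace ℂ F]
    [CompleteSpace F] {G : F →L[ℂ] F} (hG : IsSelfAdjoint G) (x y : F) :
    (inner ℂ x (G y)).re =
      4⁻¹ * (inner ℂ (x + y) (G (x + y))).re - 4⁻¹ * (inner ℂ (x - y) (G (x - y))).re := by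
  have h := QNN.re_inner_apply_comm hG x y
  simp only [map_add, map_sub, inner_add_left, inner_add_right, inner_sub_left, inner_sub_right,
    Complex.add_re, Complex.sub_re]
  linarith

theorem integral_re_inner_apply {G : F →L[ℂ] F} (hG : IsSelfAdjoint G) (x y : F) :
    ∫ U, (inner ℂ ((U : F →L[ℂ] F) x) (G ((U : F →L[ℂ] F) y))).re ∂(unitaryHaar F) =
      trRe G * (inner ℂ x y).re / Module.finrank ℂ F := by
  have h := re_inner_eq_norm_add_mul_self_sub_norm_sub_mul_self_div_four (𝕜 := ℂ) x y
  simp only [re_inner_apply_polarization hG ((_ : F →L[ℂ] F) x), ← map_add, ← map_sub]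
  rw [integral_sub (integrable_of_continuous (by fun_prop))
    (integrable_of_continuous (by fun_prop)), integral_const_mul, integral_const_mul,
    integral_re_inner_apply_self hG, integral_re_inner_apply_self hG]
  simp only [RCLike.re_to_complex] at h
  rw [h]
  ring

/-- In an eigenbasis the second moment is `(tr G² + (tr G)²) ‖z‖⁴ / (n (n + 1))`; subtracting the
squared mean leaves the bound minus a nonnegative multiple of `(tr G)²`, which is dropped. -/
theorem variance_re_inner_apply_self_le {G : F →L[ℂ] F} (hG : IsSelfAdjoint G) (z : F) :
    ProbabilityTheory.variance (fun U : unitary (F →L[ℂ] F) =>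
      (inner ℂ ((U : F →L[ℂ] F) z) (G ((U : F →L[ℂ] F) z))).re) (unitaryHaar F) ≤
      ‖z‖ ^ 4 * (trRe (star G * G) /
        (Module.finrank ℂ F * (Module.finrank ℂ F + 1))) := by
  -- The general argument divides by `n` and uses a basis vector of index `0`, so dimension zero is
  -- treated apart.
  rcases subsingleton_or_nontrivial F with hF | hF
  · simp only [Subsingleton.elim z 0, map_zero, inner_zero_left, Complex.zero_re]
    refine (ProbabilityTheory.variance_zero (unitaryHaar F)).le.trans (by simp)
  have : NeZero (Module.finrank ℂ F) := ⟨Module.finrank_pos.ne'⟩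
  have hn : 0 < (Module.finrank ℂ F : ℝ) := by exact_mod_cast Module.finrank_pos
  rw [ProbabilityTheory.variance_eq_sub (memLp_two_of_continuous (by fun_prop)),
    integral_re_inner_apply_self hG]
  obtain ⟨b, a, hb, htr, htr2⟩ := exists_eigenbasis hG
  simp only [Pi.pow_apply, re_inner_apply_eq_sum hG hb]
  rw [integral_sq_sum_norm_inner_sq_basis b 0, integral_norm_inner_pow_four_basis, ← htr, ← htr2]
  generalize (Module.finrank ℂ F : ℝ) = n at *
  have h : (trRe (star G * G) + trRe G ^ 2) * (‖z‖ ^ 4 / (n * (n + 1))) -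
      (trRe G * ‖z‖ ^ 2 / n) ^ 2 = ‖z‖ ^ 4 * (trRe (star G * G) / (n * (n + 1))) -
        trRe G ^ 2 * ‖z‖ ^ 4 / (n ^ 2 * (n + 1)) := by
    field_simp
    ring
  rw [h]
  have : 0 ≤ trRe G ^ 2 * ‖z‖ ^ 4 / (n ^ 2 * (n + 1)) := by positivity
  linarith

/-- Covariances cancel in `Var(X + Y) + Var(X - Y) = 2 Var X + 2 Var Y`. -/
theorem variance_add_le {Ω : Type*} [MeasurableSpace Ω] {m : Measure Ω} [IsProbabilityMeasure m]
    {X Y : Ω → ℝ} (hX : MemLp X 2 m) (hY : MemLp Y 2 m) :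
    ProbabilityTheory.variance (X + Y) m ≤
      2 * ProbabilityTheory.variance X m + 2 * ProbabilityTheory.variance Y m := by
  have h1 := ProbabilityTheory.variance_add hX hY
  have h2 := ProbabilityTheory.variance_sub hX hY
  have h3 := ProbabilityTheory.variance_nonneg (X - Y) m
  linarith

theorem variance_sub_le {Ω : Type*} [MeasurableSpace Ω] {m : Measure Ω} [IsProbabilityMeasure m]
    {X Y : Ω → ℝ} (hX : MemLp X 2 m) (hY : MemLp Y 2 m) :
    ProbabilityTheory.variance (X - Y) m ≤
      2 * ProbabilityTheory.variance X m + 2 * ProbabilityTheory.variance Y m := by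
  have h1 := ProbabilityTheory.variance_add hX hY
  have h2 := ProbabilityTheory.variance_sub hX hY
  have h3 := ProbabilityTheory.variance_nonneg (X + Y) m
  linarith

theorem re_inner_star_mul_self_apply {F : Type*} [NormedAddCommGroup F] [InnerProductSpace ℂ F]
    [CompleteSpace F] (G : F →L[ℂ] F) (x : F) : (inner ℂ x ((star G * G) x)).re = ‖G x‖ ^ 2 := by
  rw [mul_apply_eq_comp, ContinuousLinearMap.star_eq_adjoint,
    ContinuousLinearMap.adjoint_inner_right]
  exact inner_self_eq_norm_sq (𝕜 := ℂ) (G x)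

theorem trRe_eq_sum {F : Type*} [NormedAddCommGroup F] [InnerProductSpace ℂ F] {n : ℕ}
    (b : OrthonormalBasis (Fin n) ℂ F) (G : F →L[ℂ] F) :
    trRe G = ∑ i, (inner ℂ (b i) (G (b i))).re := by
  rw [trRe, LinearMap.trace_eq_sum_inner _ b, Complex.re_sum]
  rfl

theorem trRe_star_mul_self_nonneg (G : F →L[ℂ] F) : 0 ≤ trRe (star G * G) := by
  rw [trRe_eq_sum (stdOrthonormalBasis ℂ F)]
  simp only [re_inner_star_mul_self_apply]
  positivity

theorem variance_re_inner_apply_unit_le {G : F →L[ℂ] F} (hG : IsSelfAdjoint G) {x y : F}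
    (hx : ‖x‖ = 1) (hy : ‖y‖ = 1) :
    ProbabilityTheory.variance (fun U : unitary (F →L[ℂ] F) =>
      (inner ℂ ((U : F →L[ℂ] F) x) (G ((U : F →L[ℂ] F) y))).re) (unitaryHaar F) ≤
      2 * (trRe (star G * G) / (Module.finrank ℂ F * (Module.finrank ℂ F + 1))) := by
  simp only [re_inner_apply_polarization hG ((_ : F →L[ℂ] F) x), ← map_add, ← map_sub]
  refine (variance_sub_le (memLp_two_of_continuous (by fun_prop))
    (memLp_two_of_continuous (by fun_prop))).trans ?_
  rw [ProbabilityTheory.variance_const_mul, ProbabilityTheory.variance_const_mul]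
  have h1 := variance_re_inner_apply_self_le hG (x + y)
  have h2 := variance_re_inner_apply_self_le hG (x - y)
  have hpar := parallelogram_law_with_norm ℂ x y
  rw [hx, hy] at hpar
  have hT : 0 ≤ trRe (star G * G) / (Module.finrank ℂ F * (Module.finrank ℂ F + 1)) :=
    div_nonneg (trRe_star_mul_self_nonneg G) (by positivity)
  set T := trRe (star G * G) / (Module.finrank ℂ F * (Module.finrank ℂ F + 1))
  -- By the parallelogram law the two squared norms sum to `4`, hence their squares sum to at most
  -- `16`.
  have h4 : ‖x + y‖ ^ 4 + ‖x - y‖ ^ 4 ≤ 16 := by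
    nlinarith [mul_nonneg (sq_nonneg ‖x + y‖) (sq_nonneg ‖x - y‖)]
  nlinarith [mul_le_mul_of_nonneg_right h4 hT]

theorem variance_two_mul_re_inner_apply_le {G : F →L[ℂ] F} (hG : IsSelfAdjoint G) (x y : F) :
    ProbabilityTheory.variance (fun U : unitary (F →L[ℂ] F) =>
      2 * (inner ℂ ((U : F →L[ℂ] F) x) (G ((U : F →L[ℂ] F) y))).re) (unitaryHaar F) ≤
      8 * (trRe (star G * G) / (Module.finrank ℂ F * (Module.finrank ℂ F + 1))) *
        ‖x‖ ^ 2 * ‖y‖ ^ 2 := by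
  rcases eq_or_ne x 0 with rfl | hx
  · simp only [map_zero, inner_zero_left, Complex.zero_re, mul_zero]
    refine (ProbabilityTheory.variance_zero (unitaryHaar F)).le.trans (by simp)
  rcases eq_or_ne y 0 with rfl | hy
  · simp only [map_zero, inner_zero_right, Complex.zero_re, mul_zero]
    refine (ProbabilityTheory.variance_zero (unitaryHaar F)).le.trans (by simp)
  -- Polarization loses homogeneity in `x` and `y` separately; rescaling to unit vectors first
  -- restores the product `‖x‖² ‖y‖²`.
  have unit : ∀ w : F, w ≠ 0 → ∃ u : F, ‖u‖ = 1 ∧ w = (‖w‖ : ℂ) • u := fun w hw => by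
    have : (‖w‖ : ℂ) ≠ 0 := by simpa using hw
    exact ⟨(‖w‖ : ℂ)⁻¹ • w, by rw [norm_smul]; simp [hw],
      by rw [smul_smul, mul_inv_cancel₀ this, one_smul]⟩
  obtain ⟨u, hu, hxu⟩ := unit x hx
  obtain ⟨v, hv, hyv⟩ := unit y hy
  have h : ∀ U : unitary (F →L[ℂ] F),
      2 * (inner ℂ ((U : F →L[ℂ] F) x) (G ((U : F →L[ℂ] F) y))).re =
      (2 * ‖x‖ * ‖y‖) * (inner ℂ ((U : F →L[ℂ] F) u) (G ((U : F →L[ℂ] F) v))).re := fun U => by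
    conv_lhs => rw [hxu, hyv]
    rw [map_smul, map_smul, map_smul, inner_smul_left, inner_smul_right, Complex.conj_ofReal,
      Complex.re_ofReal_mul, Complex.re_ofReal_mul]
    ring
  simp only [h]
  rw [ProbabilityTheory.variance_const_mul]
  have := mul_le_mul_of_nonneg_left (variance_re_inner_apply_unit_le hG hu hv)
    (sq_nonneg (2 * ‖x‖ * ‖y‖))
  refine this.trans_eq ?_
  ring

end HaarMoments

/-! ### Splitting along `ψ` and compressing to its orthogonal complement -/

section Compression

variable {E : Type*} [NormedAddCommGroup E] [InnerProductSpace ℂ E]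

theorem eq_smul_add_orthogonalProjectionOnto {ψ : E} (hψ : ‖ψ‖ = 1) (x : E) :
    x = inner ℂ ψ x • ψ + ((ℂ ∙ ψ)ᗮ.orthogonalProjectionOnto x : E) := by
  have h := Submodule.starProjection_add_starProjection_orthogonal (K := ℂ ∙ ψ) x
  rw [Submodule.starProjection_unit_singleton ℂ hψ] at h
  exact h.symm

theorem inner_eq_add_inner_orthogonalProjectionOnto {ψ : E} (hψ : ‖ψ‖ = 1) (x y : E) :
    inner ℂ x y = inner ℂ x ψ * inner ℂ ψ y +
      inner ℂ ((ℂ ∙ ψ)ᗮ.orthogonalProjectionOnto x) ((ℂ ∙ ψ)ᗮ.orthogonalProjectionOnto y) := by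
  have h0 := Submodule.mem_orthogonal_singleton_iff_inner_left.1
    ((ℂ ∙ ψ)ᗮ.orthogonalProjectionOnto x).2
  rw [Submodule.inner_orthogonalProjectionOnto_eq_of_mem_left]
  nth_rewrite 1 [eq_smul_add_orthogonalProjectionOnto hψ x]
  rw [inner_add_left, inner_smul_left, inner_conj_symm]

theorem sq_norm_orthogonalProjectionOnto {ψ : E} (hψ : ‖ψ‖ = 1) (x : E) :
    ‖(ℂ ∙ ψ)ᗮ.orthogonalProjectionOnto x‖ ^ 2 = ‖x‖ ^ 2 - ‖inner ℂ ψ x‖ ^ 2 := by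
  have hsq : ∀ {F : Type _} [NormedAddCommGroup F] [InnerProductSpace ℂ F] (y : F),
      (inner ℂ y y).re = ‖y‖ ^ 2 := fun y => inner_self_eq_norm_sq (𝕜 := ℂ) y
  have h := congrArg Complex.re (inner_eq_add_inner_orthogonalProjectionOnto hψ x x)
  rw [Complex.add_re, hsq, hsq, ← inner_conj_symm, Complex.conj_mul', ← Complex.ofReal_pow,
    Complex.ofReal_re] at h
  linarith

theorem blockOperator_apply [CompleteSpace E] {ψ : E} (hψ : ‖ψ‖ = 1) (U : (ℂ ∙ ψ)ᗮ →L[ℂ] (ℂ ∙ ψ)ᗮ) (x : E) :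
    blockOperator (ℂ ∙ ψ)ᗮ U x =
      inner ℂ ψ x • ψ + (U ((ℂ ∙ ψ)ᗮ.orthogonalProjectionOnto x) : E) := by
  have h : x - (ℂ ∙ ψ)ᗮ.starProjection x = inner ℂ ψ x • ψ :=
    sub_eq_of_eq_add (eq_smul_add_orthogonalProjectionOnto hψ x)
  rw [← h]
  simp [blockOperator]

variable [FiniteDimensional ℂ E]

/-- The compression `P A P` of an operator to a subspace. -/
def compression (K : Submodule ℂ E) (A : E →L[ℂ] E) : K →L[ℂ] K :=
  K.orthogonalProjectionOnto ∘L A ∘L K.subtypeL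

theorem inner_orthogonalProjectionOnto (K : Submodule ℂ E) (u : K) (x : E) :
    inner ℂ u (K.orthogonalProjectionOnto x) = inner ℂ (u : E) x :=
  Submodule.inner_orthogonalProjectionOnto_eq_of_mem_left u x

theorem inner_compression (K : Submodule ℂ E) (A : E →L[ℂ] E) (u v : K) :
    inner ℂ u (compression K A v) = inner ℂ (u : E) (A v) :=
  inner_orthogonalProjectionOnto K u (A v)

theorem norm_compression_apply_le (K : Submodule ℂ E) (A : E →L[ℂ] E) (u : K) :
    ‖compression K A u‖ ≤ ‖A u‖ :=
  Submodule.norm_orthogonalProjectionOnto_apply_le K (A u)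

/-- Write `A = |Aψ⟩⟨ψ| + A P`: the rank-one part has trace `⟨ψ, A ψ⟩`, and cyclicity moves the
projection in `A P` to the left. -/
theorem trace_compression {ψ : E} (hψ : ‖ψ‖ = 1) (A : E →L[ℂ] E) :
    LinearMap.trace ℂ _ (compression (ℂ ∙ ψ)ᗮ A : (ℂ ∙ ψ)ᗮ →ₗ[ℂ] (ℂ ∙ ψ)ᗮ) =
      LinearMap.trace ℂ E (A : E →ₗ[ℂ] E) - inner ℂ ψ (A ψ) := by
  have h1 : (A : E →ₗ[ℂ] E) = (InnerProductSpace.rankOne ℂ (A ψ) ψ : E →L[ℂ] E) +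
      ((A : E →ₗ[ℂ] E) ∘ₗ (ℂ ∙ ψ)ᗮ.subtype) ∘ₗ
        ((ℂ ∙ ψ)ᗮ.orthogonalProjectionOnto : E →ₗ[ℂ] (ℂ ∙ ψ)ᗮ) := by
    ext x
    have h := congrArg A (eq_smul_add_orthogonalProjectionOnto hψ x)
    rw [map_add, map_smul] at h
    simpa using h
  have h2 := congrArg (LinearMap.trace ℂ E) h1
  rw [map_add, InnerProductSpace.trace_rankOne, LinearMap.trace_comp_comm'] at h2
  rw [h2]
  simp [compression]

theorem trRe_compression {ψ : E} (hψ : ‖ψ‖ = 1) (A : E →L[ℂ] E) :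
    trRe (compression (ℂ ∙ ψ)ᗮ A) = trRe A - expval ψ A := by
  rw [trRe, trace_compression hψ, trRe, expval, Complex.sub_re]

variable [CompleteSpace E]

theorem isSelfAdjoint_compression (K : Submodule ℂ E) {A : E →L[ℂ] E} (hA : IsSelfAdjoint A) :
    IsSelfAdjoint (compression K A) := by
  rw [ContinuousLinearMap.isSelfAdjoint_iff_isSymmetric]
  intro u v
  have h : inner ℂ (A u) (v : E) = inner ℂ (u : E) (A v) := hA.isSymmetric (u : E) (v : E)
  change inner ℂ (compression K A u) v = inner ℂ u (compression K A v)
  rw [inner_compression, ← h, ← inner_conj_symm, inner_compression, inner_conj_symm]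

/-- Termwise in an orthonormal basis this is `‖P A u‖² ≤ ‖A u‖²`. -/
theorem trRe_star_compression_mul_self_le_trRe_compression (K : Submodule ℂ E) (A : E →L[ℂ] E) :
    trRe (star (compression K A) * compression K A) ≤ trRe (compression K (star A * A)) := by
  rw [trRe_eq_sum (stdOrthonormalBasis ℂ K), trRe_eq_sum (stdOrthonormalBasis ℂ K)]
  have h : ∀ u : K, (inner ℂ u ((star (compression K A) * compression K A) u)).re ≤
      (inner ℂ u (compression K (star A * A) u)).re := fun u => by
    rw [re_inner_star_mul_self_apply, inner_compression, re_inner_star_mul_self_apply]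
    exact pow_le_pow_left₀ (norm_nonneg _) (norm_compression_apply_le K A u) 2
  exact Finset.sum_le_sum fun i _ => h _

theorem trRe_star_compression_mul_self_le {ψ : E} (hψ : ‖ψ‖ = 1) (A : E →L[ℂ] E) :
    trRe (star (compression (ℂ ∙ ψ)ᗮ A) * compression (ℂ ∙ ψ)ᗮ A) ≤ trRe (star A * A) := by
  have h0 : expval ψ (star A * A) = ‖A ψ‖ ^ 2 := re_inner_star_mul_self_apply A ψ
  have h1 := trRe_compression hψ (star A * A)
  have h2 := trRe_star_compression_mul_self_le_trRe_compression (ℂ ∙ ψ)ᗮ A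
  have h3 := sq_nonneg ‖A ψ‖
  linarith

/-- A matrix element of `V† A V` in terms of the compression of `A`. -/
theorem re_inner_blockOperator {ψ : E} (hψ : ‖ψ‖ = 1) {A : E →L[ℂ] E} (hA : IsSelfAdjoint A)
    (U : (ℂ ∙ ψ)ᗮ →L[ℂ] (ℂ ∙ ψ)ᗮ) (x y : E) :
    (inner ℂ x ((star (blockOperator (ℂ ∙ ψ)ᗮ U) * A * blockOperator (ℂ ∙ ψ)ᗮ U) y)).re =
      (inner ℂ x ψ * inner ℂ ψ y).re * expval ψ A +
      (inner ℂ (U (inner ℂ x ψ • (ℂ ∙ ψ)ᗮ.orthogonalProjectionOnto y +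
        inner ℂ y ψ • (ℂ ∙ ψ)ᗮ.orthogonalProjectionOnto x))
        ((ℂ ∙ ψ)ᗮ.orthogonalProjectionOnto (A ψ))).re +
      (inner ℂ (U ((ℂ ∙ ψ)ᗮ.orthogonalProjectionOnto x))
        (compression (ℂ ∙ ψ)ᗮ A (U ((ℂ ∙ ψ)ᗮ.orthogonalProjectionOnto y)))).re := by
  have hreal : inner ℂ ψ (A ψ) = (expval ψ A : ℂ) :=
    (hA.isSymmetric.coe_re_inner_self_apply ψ).symm
  rw [mul_apply_eq_comp, mul_apply_eq_comp, ContinuousLinearMap.star_eq_adjoint,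
    ContinuousLinearMap.adjoint_inner_right, blockOperator_apply hψ, blockOperator_apply hψ]
  generalize (ℂ ∙ ψ)ᗮ.orthogonalProjectionOnto x = u
  generalize (ℂ ∙ ψ)ᗮ.orthogonalProjectionOnto y = v
  -- One of the two cross terms has `U` in the right slot. Conjugation keeps its real part and moves
  -- `U` to the left, so both pair with `P A ψ`.
  have h1 : (inner ℂ x ψ * inner ℂ ψ (A (U v))).re =
      (inner ℂ ψ x * inner ℂ (U v : E) (A ψ)).re := by
    rw [← hA.isSymmetric.apply_clm ψ, ← inner_conj_symm, ← inner_conj_symm (A ψ), ← map_mul,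
      Complex.conj_re]
  rw [inner_compression, inner_orthogonalProjectionOnto, map_add, map_smul, map_add, map_smul,
    map_smul, Submodule.coe_add, Submodule.coe_smul, Submodule.coe_smul]
  simp only [inner_add_left, inner_add_right, inner_smul_left, inner_smul_right, hreal,
    inner_conj_symm, Complex.add_re, mul_add] at h1 ⊢
  rw [h1, ← mul_assoc, Complex.re_mul_ofReal, mul_comm (inner ℂ ψ y) (inner ℂ x ψ)]
  ring

end Compression

/-! ### Transfer from the ensemble to Haar measure on the complement -/

section Ensemble

variable {E : Type*} [NormedAddCommGroup E] [InnerProductSpace ℂ E]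

theorem finrank_orthogonal_span_unit [FiniteDimensional ℂ E] {ψ : E} (hψ : ‖ψ‖ = 1) :
    (Module.finrank ℂ (ℂ ∙ ψ)ᗮ : ℝ) = Module.finrank ℂ E - 1 := by
  have h := Submodule.finrank_add_finrank_orthogonal (ℂ ∙ ψ)
  rw [finrank_span_singleton (by rintro rfl; simp at hψ)] at h
  rw [← h]
  push_cast
  ring

variable [CompleteSpace E]

theorem isSelfAdjoint_conj {H : E →L[ℂ] E} (hH : IsSelfAdjoint H) (V : E →L[ℂ] E) :
    IsSelfAdjoint (star V * H * V) := by
  simp [isSelfAdjoint_iff, star_mul, hH.star_eq, mul_assoc]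

theorem sq_norm_orthogonalProjectionOnto_apply {ψ : E} (hψ : ‖ψ‖ = 1) {H : E →L[ℂ] E}
    (hH : IsSelfAdjoint H) : ‖(ℂ ∙ ψ)ᗮ.orthogonalProjectionOnto (H ψ)‖ ^ 2 =
      expval ψ (H * H) - expval ψ H ^ 2 := by
  have hreal : inner ℂ ψ (H ψ) = (expval ψ H : ℂ) :=
    (hH.isSymmetric.coe_re_inner_self_apply ψ).symm
  have h : expval ψ (H * H) = ‖H ψ‖ ^ 2 := by
    have := re_inner_star_mul_self_apply H ψ
    rwa [hH.star_eq] at this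
  rw [sq_norm_orthogonalProjectionOnto hψ, hreal, h]
  simp

variable [FiniteDimensional ℂ E]

theorem integral_stateEnsemble (ψ : E) {f : unitary (E →L[ℂ] E) → ℝ} (hf : Continuous f) :
    ∫ V, f V ∂(stateEnsemble ψ) =
      ∫ U, f (blockUnitary (ℂ ∙ ψ)ᗮ U) ∂(unitaryHaar (ℂ ∙ ψ)ᗮ) :=
  integral_map (continuous_blockUnitary _).measurable.aemeasurable hf.aestronglyMeasurable

theorem variance_stateEnsemble (ψ : E) {f : unitary (E →L[ℂ] E) → ℝ} (hf : Continuous f) :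
    ProbabilityTheory.variance f (stateEnsemble ψ) =
      ProbabilityTheory.variance (fun U => f (blockUnitary (ℂ ∙ ψ)ᗮ U))
        (unitaryHaar (ℂ ∙ ψ)ᗮ) :=
  ProbabilityTheory.variance_map hf.measurable.aemeasurable
    (continuous_blockUnitary _).measurable.aemeasurable

theorem schattenTwoNorm_sq (H : E →L[ℂ] E) : schattenTwoNorm H ^ 2 = trRe (star H * H) :=
  Real.sq_sqrt (trRe_star_mul_self_nonneg H)

end Ensemble

/-! ### Gradient and Hessian of the loss as random variables -/

namespace QNN

variable {E : Type*} [NormedAddCommGroup E] [InnerProductSpace ℂ E] [CompleteSpace E] {M : ℕ}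

/-- The component of `∂_μ ψ` orthogonal to `ψ`. -/
def tangent (Q : QNN E M) (θ : Fin M → ℝ) (μ : Fin M) : (ℂ ∙ Q.output θ)ᗮ :=
  (ℂ ∙ Q.output θ)ᗮ.orthogonalProjectionOnto (Q.outputFst θ μ)

/-- The vector whose pairing with `P H ψ` is the part of the Hessian linear in the random
unitary. -/
def hessVector (Q : QNN E M) (θ : Fin M → ℝ) (μ ν : Fin M) : (ℂ ∙ Q.output θ)ᗮ :=
  (ℂ ∙ Q.output θ)ᗮ.orthogonalProjectionOnto (Q.outputSnd θ μ ν) +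
    (inner ℂ (Q.outputFst θ μ) (Q.output θ) • Q.tangent θ ν +
      inner ℂ (Q.outputFst θ ν) (Q.output θ) • Q.tangent θ μ)

/-- The term subtracted in the Fisher matrix is exactly the contribution of the components along
`ψ`. -/
theorem qfi_eq (Q : QNN E M) (θ : Fin M → ℝ) (μ ν : Fin M) :
    Q.qfi θ μ ν = 2 * (inner ℂ (Q.tangent θ μ) (Q.tangent θ ν)).re := by
  rw [qfi, partialDeriv_output, partialDeriv_output,
    inner_eq_add_inner_orthogonalProjectionOnto (Q.norm_output θ), add_sub_cancel_left]
  rfl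

theorem qfi_self_eq (Q : QNN E M) (θ : Fin M → ℝ) (μ : Fin M) :
    Q.qfi θ μ μ = 2 * ‖Q.tangent θ μ‖ ^ 2 := by
  rw [qfi_eq]
  exact congrArg (2 * ·) (inner_self_eq_norm_sq (𝕜 := ℂ) (Q.tangent θ μ))

theorem sq_norm_tangent (Q : QNN E M) (θ : Fin M → ℝ) (μ : Fin M) :
    ‖Q.tangent θ μ‖ ^ 2 =
      ‖Q.outputFst θ μ‖ ^ 2 - ‖inner ℂ (Q.outputFst θ μ) (Q.output θ)‖ ^ 2 := by
  rw [norm_inner_symm]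
  exact sq_norm_orthogonalProjectionOnto (Q.norm_output θ) (Q.outputFst θ μ)

theorem norm_tangent_le (Q : QNN E M) (θ : Fin M → ℝ) (μ : Fin M) :
    ‖Q.tangent θ μ‖ ≤ ‖Q.generator μ‖ :=
  (Submodule.norm_orthogonalProjectionOnto_apply_le _ _).trans (Q.norm_outputFst_le θ μ)

/-- The second derivative contributes one factor `‖Ω_μ‖ ‖Ω_ν‖`. The two correction terms together
contribute only one more, by Cauchy–Schwarz for the pairs `(a, ‖t_μ‖)` and `(‖t_ν‖, b)`, where `a`,
`b` are the overlaps with `ψ`. -/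
theorem norm_hessVector_le (Q : QNN E M) (θ : Fin M → ℝ) (μ ν : Fin M) :
    ‖Q.hessVector θ μ ν‖ ≤ 2 * (‖Q.generator μ‖ * ‖Q.generator ν‖) := by
  have h1 : ‖(ℂ ∙ Q.output θ)ᗮ.orthogonalProjectionOnto (Q.outputSnd θ μ ν)‖ ≤
      ‖Q.generator μ‖ * ‖Q.generator ν‖ :=
    (Submodule.norm_orthogonalProjectionOnto_apply_le _ _).trans (Q.norm_outputSnd_le θ μ ν)
  have h2 : ‖inner ℂ (Q.outputFst θ μ) (Q.output θ) • Q.tangent θ ν +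
      inner ℂ (Q.outputFst θ ν) (Q.output θ) • Q.tangent θ μ‖ ≤
      ‖Q.generator μ‖ * ‖Q.generator ν‖ := by
    refine (norm_add_le _ _).trans ?_
    rw [norm_smul, norm_smul]
    have hμ := Q.sq_norm_tangent θ μ
    have hν := Q.sq_norm_tangent θ ν
    refine le_trans ?_ (mul_le_mul (Q.norm_outputFst_le θ μ) (Q.norm_outputFst_le θ ν)
      (norm_nonneg _) (norm_nonneg _))
    refine abs_le_of_sq_le_sq' ?_ (by positivity) |>.2
    generalize ‖inner ℂ (Q.outputFst θ μ) (Q.output θ)‖ = a at *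
    generalize ‖inner ℂ (Q.outputFst θ ν) (Q.output θ)‖ = b at *
    have e1 : ‖Q.outputFst θ μ‖ ^ 2 = ‖Q.tangent θ μ‖ ^ 2 + a ^ 2 := by linarith
    have e2 : ‖Q.outputFst θ ν‖ ^ 2 = ‖Q.tangent θ ν‖ ^ 2 + b ^ 2 := by linarith
    rw [mul_pow ‖Q.outputFst θ μ‖, e1, e2]
    -- Lagrange's identity: this square is exactly the defect in Cauchy–Schwarz.
    nlinarith [sq_nonneg (a * b - ‖Q.tangent θ μ‖ * ‖Q.tangent θ ν‖)]
  rw [two_mul]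
  exact (norm_add_le _ _).trans (add_le_add h1 h2)

theorem continuous_lossGrad (Q : QNN E M) {H : E →L[ℂ] E} (hH : IsSelfAdjoint H)
    (θ : Fin M → ℝ) (μ : Fin M) : Continuous (Q.lossGrad H θ μ) := by
  have h : Q.lossGrad H θ μ = fun V : unitary (E →L[ℂ] E) => 2 * (inner ℂ (Q.outputFst θ μ)
      ((star (V : E →L[ℂ] E) * H * (V : E →L[ℂ] E)) (Q.output θ))).re :=
    funext fun V => congrFun (Q.partialDeriv_loss (isSelfAdjoint_conj hH V) μ) θ
  rw [h]
  fun_prop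

theorem continuous_lossHess (Q : QNN E M) {H : E →L[ℂ] E} (hH : IsSelfAdjoint H)
    (θ : Fin M → ℝ) (μ ν : Fin M) : Continuous (Q.lossHess H θ μ ν) := by
  have h : Q.lossHess H θ μ ν = fun V : unitary (E →L[ℂ] E) =>
      2 * (inner ℂ (Q.outputSnd θ μ ν)
        ((star (V : E →L[ℂ] E) * H * (V : E →L[ℂ] E)) (Q.output θ))).re +
      2 * (inner ℂ (Q.outputFst θ μ)
        ((star (V : E →L[ℂ] E) * H * (V : E →L[ℂ] E)) (Q.outputFst θ ν))).re :=
    funext fun V => Q.partialDeriv_partialDeriv_loss (isSelfAdjoint_conj hH V) θ μ ν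
  rw [h]
  fun_prop

variable [FiniteDimensional ℂ E]

theorem re_inner_blockUnitary_output (Q : QNN E M) {H : E →L[ℂ] E} (hH : IsSelfAdjoint H)
    (θ : Fin M → ℝ) (U : unitary ((ℂ ∙ Q.output θ)ᗮ →L[ℂ] (ℂ ∙ Q.output θ)ᗮ)) (x : E) :
    (inner ℂ x ((star (blockUnitary _ U : E →L[ℂ] E) * H * (blockUnitary _ U : E →L[ℂ] E))
        (Q.output θ))).re =
      (inner ℂ x (Q.output θ)).re * Q.loss H θ +
      (inner ℂ ((U : (ℂ ∙ Q.output θ)ᗮ →L[ℂ] (ℂ ∙ Q.output θ)ᗮ)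
        ((ℂ ∙ Q.output θ)ᗮ.orthogonalProjectionOnto x))
        ((ℂ ∙ Q.output θ)ᗮ.orthogonalProjectionOnto (H (Q.output θ)))).re := by
  have h1 : inner ℂ (Q.output θ) (Q.output θ) = (1 : ℂ) := by
    rw [inner_self_eq_norm_sq_to_K, Q.norm_output]; simp
  have h := re_inner_blockOperator (Q.norm_output θ) hH U x (Q.output θ)
  rw [h1, Submodule.orthogonalProjectionOnto_orthogonalComplement_singleton_eq_zero, smul_zero,
    zero_add, one_smul, mul_one, map_zero, map_zero, inner_zero_right, Complex.zero_re,
    add_zero] at h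
  exact h

theorem lossGrad_blockUnitary (Q : QNN E M) {H : E →L[ℂ] E} (hH : IsSelfAdjoint H)
    (θ : Fin M → ℝ) (μ : Fin M)
    (U : unitary ((ℂ ∙ Q.output θ)ᗮ →L[ℂ] (ℂ ∙ Q.output θ)ᗮ)) :
    Q.lossGrad H θ μ (blockUnitary _ U) =
      2 * (inner ℂ ((U : (ℂ ∙ Q.output θ)ᗮ →L[ℂ] (ℂ ∙ Q.output θ)ᗮ) (Q.tangent θ μ))
        ((ℂ ∙ Q.output θ)ᗮ.orthogonalProjectionOnto (H (Q.output θ)))).re := by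
  rw [lossGrad, Q.partialDeriv_loss (isSelfAdjoint_conj hH _) μ]
  beta_reduce
  rw [Q.re_inner_blockUnitary_output hH θ U, re_inner_outputFst_output, zero_mul, zero_add]
  rfl

theorem lossHess_blockUnitary (Q : QNN E M) {H : E →L[ℂ] E} (hH : IsSelfAdjoint H)
    (θ : Fin M → ℝ) (μ ν : Fin M)
    (U : unitary ((ℂ ∙ Q.output θ)ᗮ →L[ℂ] (ℂ ∙ Q.output θ)ᗮ)) :
    Q.lossHess H θ μ ν (blockUnitary _ U) =
      -(Q.qfi θ μ ν * Q.loss H θ) +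
      (2 * (inner ℂ ((U : (ℂ ∙ Q.output θ)ᗮ →L[ℂ] (ℂ ∙ Q.output θ)ᗮ) (Q.hessVector θ μ ν))
        ((ℂ ∙ Q.output θ)ᗮ.orthogonalProjectionOnto (H (Q.output θ)))).re +
      2 * (inner ℂ ((U : (ℂ ∙ Q.output θ)ᗮ →L[ℂ] (ℂ ∙ Q.output θ)ᗮ) (Q.tangent θ μ))
        (compression (ℂ ∙ Q.output θ)ᗮ H
          ((U : (ℂ ∙ Q.output θ)ᗮ →L[ℂ] (ℂ ∙ Q.output θ)ᗮ) (Q.tangent θ ν)))).re) := by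
  have h : (inner ℂ (Q.outputFst θ μ) ((star (blockUnitary _ U : E →L[ℂ] E) * H *
      (blockUnitary _ U : E →L[ℂ] E)) (Q.outputFst θ ν))).re =
      (inner ℂ (Q.outputFst θ μ) (Q.output θ) *
        inner ℂ (Q.output θ) (Q.outputFst θ ν)).re * Q.loss H θ +
      (inner ℂ ((U : (ℂ ∙ Q.output θ)ᗮ →L[ℂ] (ℂ ∙ Q.output θ)ᗮ)
        (inner ℂ (Q.outputFst θ μ) (Q.output θ) • Q.tangent θ ν +
          inner ℂ (Q.outputFst θ ν) (Q.output θ) • Q.tangent θ μ))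
        ((ℂ ∙ Q.output θ)ᗮ.orthogonalProjectionOnto (H (Q.output θ)))).re +
      (inner ℂ ((U : (ℂ ∙ Q.output θ)ᗮ →L[ℂ] (ℂ ∙ Q.output θ)ᗮ) (Q.tangent θ μ))
        (compression (ℂ ∙ Q.output θ)ᗮ H
          ((U : (ℂ ∙ Q.output θ)ᗮ →L[ℂ] (ℂ ∙ Q.output θ)ᗮ) (Q.tangent θ ν)))).re :=
    re_inner_blockOperator (Q.norm_output θ) hH U (Q.outputFst θ μ) (Q.outputFst θ ν)
  have hq : (inner ℂ (Q.outputFst θ μ) (Q.outputFst θ ν)).re =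
      (inner ℂ (Q.outputFst θ μ) (Q.output θ) * inner ℂ (Q.output θ) (Q.outputFst θ ν)).re +
        (inner ℂ (Q.tangent θ μ) (Q.tangent θ ν)).re :=
    congrArg Complex.re (inner_eq_add_inner_orthogonalProjectionOnto (Q.norm_output θ)
      (Q.outputFst θ μ) (Q.outputFst θ ν))
  have hq' := Q.qfi_eq θ μ ν
  rw [lossHess, Q.partialDeriv_partialDeriv_loss (isSelfAdjoint_conj hH _),
    Q.re_inner_blockUnitary_output hH θ U, re_inner_outputSnd_output, h, hessVector,
    map_add (U : (ℂ ∙ Q.output θ)ᗮ →L[ℂ] (ℂ ∙ Q.output θ)ᗮ)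
      ((ℂ ∙ Q.output θ)ᗮ.orthogonalProjectionOnto (Q.outputSnd θ μ ν)), inner_add_left,
    Complex.add_re]
  -- The constants are `-2 L Re ⟨∂_μ ψ, ∂_ν ψ⟩` and `2 L Re(⟨∂_μ ψ, ψ⟩ ⟨ψ, ∂_ν ψ⟩)`; their sum is
  -- `-F_μν L`.
  linear_combination (-2 * Q.loss H θ) * hq + Q.loss H θ * hq'

theorem integral_lossGrad (Q : QNN E M) {H : E →L[ℂ] E} (hH : IsSelfAdjoint H)
    (θ : Fin M → ℝ) (μ : Fin M) :
    ∫ V, Q.lossGrad H θ μ V ∂(stateEnsemble (Q.output θ)) = 0 := by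
  rw [integral_stateEnsemble _ (Q.continuous_lossGrad hH θ μ)]
  simp only [Q.lossGrad_blockUnitary hH, integral_const_mul]
  rw [integral_re_inner, mul_zero]

theorem variance_lossGrad (Q : QNN E M) {H : E →L[ℂ] E} (hH : IsSelfAdjoint H)
    (θ : Fin M → ℝ) (μ : Fin M) :
    ProbabilityTheory.variance (Q.lossGrad H θ μ) (stateEnsemble (Q.output θ)) =
      (expval (Q.output θ) (H * H) - expval (Q.output θ) H ^ 2) /
        ((Module.finrank ℂ E : ℝ) - 1) * Q.qfi θ μ μ := by
  rw [variance_stateEnsemble _ (Q.continuous_lossGrad hH θ μ)]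
  simp only [Q.lossGrad_blockUnitary hH]
  rw [variance_two_mul_re_inner, sq_norm_orthogonalProjectionOnto_apply (Q.norm_output θ) hH,
    finrank_orthogonal_span_unit (Q.norm_output θ), qfi_self_eq]
  ring

theorem integral_lossHess (Q : QNN E M) {H : E →L[ℂ] E} (hH : IsSelfAdjoint H)
    (hd : 2 ≤ Module.finrank ℂ E) (θ : Fin M → ℝ) (μ ν : Fin M) :
    ∫ V, Q.lossHess H θ μ ν V ∂(stateEnsemble (Q.output θ)) =
      (trRe H - (Module.finrank ℂ E : ℝ) * Q.loss H θ) / ((Module.finrank ℂ E : ℝ) - 1) *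
        Q.qfi θ μ ν := by
  have htr : trRe (compression (ℂ ∙ Q.output θ)ᗮ H) = trRe H - Q.loss H θ :=
    trRe_compression (Q.norm_output θ) H
  have hd' : (Module.finrank ℂ E : ℝ) - 1 ≠ 0 := by
    have : (2 : ℝ) ≤ Module.finrank ℂ E := by exact_mod_cast hd
    linarith
  rw [integral_stateEnsemble _ (Q.continuous_lossHess hH θ μ ν)]
  simp only [Q.lossHess_blockUnitary hH]
  rw [integral_add (integrable_of_continuous (by fun_prop))
    (integrable_of_continuous (by fun_prop)), integral_add (integrable_of_continuous (by fun_prop))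
    (integrable_of_continuous (by fun_prop)), integral_const_mul, integral_const_mul,
    integral_re_inner, integral_re_inner_apply (isSelfAdjoint_compression _ hH), htr,
    finrank_orthogonal_span_unit (Q.norm_output θ), qfi_eq]
  simp only [integral_const, probReal_univ, one_smul]
  field_simp
  ring

theorem variance_lossHess_le (Q : QNN E M) {H : E →L[ℂ] E} (hH : IsSelfAdjoint H)
    (hd : 3 ≤ Module.finrank ℂ E) (θ : Fin M → ℝ) (μ ν : Fin M) :
    ProbabilityTheory.variance (Q.lossHess H θ μ ν) (stateEnsemble (Q.output θ)) ≤
      32 * ((expval (Q.output θ) (H * H) - expval (Q.output θ) H ^ 2) /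
          ((Module.finrank ℂ E : ℝ) - 1) +
        2 * schattenTwoNorm H ^ 2 /
          ((Module.finrank ℂ E : ℝ) * ((Module.finrank ℂ E : ℝ) - 2))) *
        ‖Q.generator μ‖ ^ 2 * ‖Q.generator ν‖ ^ 2 := by
  have hG := isSelfAdjoint_compression (ℂ ∙ Q.output θ)ᗮ hH
  have h1 := variance_two_mul_re_inner
    ((ℂ ∙ Q.output θ)ᗮ.orthogonalProjectionOnto (H (Q.output θ))) (Q.hessVector θ μ ν)
  have h2 := variance_two_mul_re_inner_apply_le hG (Q.tangent θ μ) (Q.tangent θ ν)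
  have h3 := trRe_star_compression_mul_self_le (Q.norm_output θ) H
  have h4 := sq_norm_orthogonalProjectionOnto_apply (Q.norm_output θ) hH
  have h5 : ‖Q.hessVector θ μ ν‖ ^ 2 ≤ 4 * (‖Q.generator μ‖ ^ 2 * ‖Q.generator ν‖ ^ 2) :=
    (pow_le_pow_left₀ (norm_nonneg _) (Q.norm_hessVector_le θ μ ν) 2).trans_eq (by ring)
  have h6 : ‖Q.tangent θ μ‖ ^ 2 * ‖Q.tangent θ ν‖ ^ 2 ≤
      ‖Q.generator μ‖ ^ 2 * ‖Q.generator ν‖ ^ 2 := by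
    gcongr <;> exact Q.norm_tangent_le θ _
  have hT := trRe_star_mul_self_nonneg (compression (ℂ ∙ Q.output θ)ᗮ H)
  have hd' : (3 : ℝ) ≤ Module.finrank ℂ E := by exact_mod_cast hd
  rw [finrank_orthogonal_span_unit (Q.norm_output θ), h4] at h1
  rw [finrank_orthogonal_span_unit (Q.norm_output θ)] at h2
  have hσ := h4 ▸ sq_nonneg ‖(ℂ ∙ Q.output θ)ᗮ.orthogonalProjectionOnto (H (Q.output θ))‖
  rw [variance_stateEnsemble _ (Q.continuous_lossHess hH θ μ ν), schattenTwoNorm_sq]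
  simp only [Q.lossHess_blockUnitary hH]
  have hX : Continuous fun U : unitary ((ℂ ∙ Q.output θ)ᗮ →L[ℂ] (ℂ ∙ Q.output θ)ᗮ) =>
      2 * (inner ℂ ((U : (ℂ ∙ Q.output θ)ᗮ →L[ℂ] (ℂ ∙ Q.output θ)ᗮ) (Q.hessVector θ μ ν))
        ((ℂ ∙ Q.output θ)ᗮ.orthogonalProjectionOnto (H (Q.output θ)))).re := by fun_prop
  have hY : Continuous fun U : unitary ((ℂ ∙ Q.output θ)ᗮ →L[ℂ] (ℂ ∙ Q.output θ)ᗮ) =>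
      2 * (inner ℂ ((U : (ℂ ∙ Q.output θ)ᗮ →L[ℂ] (ℂ ∙ Q.output θ)ᗮ) (Q.tangent θ μ))
        (compression (ℂ ∙ Q.output θ)ᗮ H
          ((U : (ℂ ∙ Q.output θ)ᗮ →L[ℂ] (ℂ ∙ Q.output θ)ᗮ) (Q.tangent θ ν)))).re := by fun_prop
  refine (ProbabilityTheory.variance_const_add (hX.add hY).aestronglyMeasurable _).le.trans ?_
  refine (variance_add_le (memLp_two_of_continuous hX) (memLp_two_of_continuous hY)).trans ?_
  rw [h1]
  refine (add_le_add le_rfl (mul_le_mul_of_nonneg_left h2 zero_le_two)).trans ?_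
  generalize expval (Q.output θ) (H * H) - expval (Q.output θ) H ^ 2 = σ at *
  generalize trRe (star (compression (ℂ ∙ Q.output θ)ᗮ H) *
    compression (ℂ ∙ Q.output θ)ᗮ H) = T at *
  generalize trRe (star H * H) = S at *
  generalize (Module.finrank ℂ E : ℝ) = d at *
  have hg : 0 ≤ ‖Q.generator μ‖ ^ 2 * ‖Q.generator ν‖ ^ 2 := by positivity
  generalize ‖Q.generator μ‖ ^ 2 = A at *
  generalize ‖Q.generator ν‖ ^ 2 = B at *
  have hd1 : 0 < d - 1 := by linarith
  have hd2 : 0 < d - 2 := by linarith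
  have hd0 : 0 < d := by linarith
  -- The constant 16 is `2` from splitting the variance, `2` from the linear moment and `4` from the
  -- squared bound on `hessVector`.
  have hlin : 2 * (2 * σ * ‖Q.hessVector θ μ ν‖ ^ 2 / (d - 1)) ≤ 16 * (σ / (d - 1)) * (A * B) := by
    have := mul_le_mul_of_nonneg_left h5 (div_nonneg hσ hd1.le)
    calc _ = 4 * (σ / (d - 1) * ‖Q.hessVector θ μ ν‖ ^ 2) := by ring
      _ ≤ 4 * (σ / (d - 1) * (4 * (A * B))) := by gcongr
      _ = _ := by ring
  -- Here `T ≤ S` and `d (d - 2) ≤ (d - 1) d`; positivity of `d - 2` comes from `3 ≤ d`.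
  have hTS : T / ((d - 1) * (d - 1 + 1)) ≤ S / (d * (d - 2)) := by
    refine div_le_div₀ (hT.trans h3) h3 (by positivity) ?_
    nlinarith
  have hT0 : 0 ≤ T / ((d - 1) * (d - 1 + 1)) := div_nonneg hT (by nlinarith)
  have hquad : 2 * (8 * (T / ((d - 1) * (d - 1 + 1))) * ‖Q.tangent θ μ‖ ^ 2 *
      ‖Q.tangent θ ν‖ ^ 2) ≤ 16 * (S / (d * (d - 2))) * (A * B) := by
    calc _ = 16 * (T / ((d - 1) * (d - 1 + 1))) *
          (‖Q.tangent θ μ‖ ^ 2 * ‖Q.tangent θ ν‖ ^ 2) := by ring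
      _ ≤ 16 * (S / (d * (d - 2))) * (A * B) :=
        mul_le_mul (by linarith) h6 (by positivity) (by linarith)
  have hr1 := mul_nonneg (div_nonneg hσ hd1.le) hg
  have hr2 := mul_nonneg (hT0.trans hTS) hg
  -- The estimates give coefficients 16 and 16, so the claimed 32 and 64 follow from nonnegativity
  -- of both terms.
  have : 32 * (σ / (d - 1) + 2 * S / (d * (d - 2))) * A * B =
      32 * (σ / (d - 1) * (A * B)) + 64 * (S / (d * (d - 2)) * (A * B)) := by ring
  rw [this]
  linarith

end QNN

end

theorem mainTheorem5 {E : Type*} [NormedAddCommGroup E] [InnerProductSpace ℂ E]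
    [CompleteSpace E] [FiniteDimensional ℂ E] (d : ℕ) (hd : Module.finrank ℂ E = d) (hd2 : 2 ≤ d)
    {M : ℕ} (Q : QNN E M) (H : E →L[ℂ] E) (hH : IsSelfAdjoint H) (θ : Fin M → ℝ) :
    (∀ V : unitary (E →L[ℂ] E), ContDiff ℝ ((⊤ : ℕ∞) : WithTop ℕ∞)
      (Q.loss (star (V : E →L[ℂ] E) * H * (V : E →L[ℂ] E)))) ∧
    (∀ μ, MemLp (Q.lossGrad H θ μ) 2 (stateEnsemble (Q.output θ))) ∧
    (∀ μ ν, MemLp (Q.lossHess H θ μ ν) 2 (stateEnsemble (Q.output θ))) ∧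
    (∀ μ, ∫ V, Q.lossGrad H θ μ V ∂(stateEnsemble (Q.output θ)) = 0) ∧
    (∀ μ, ProbabilityTheory.variance (Q.lossGrad H θ μ) (stateEnsemble (Q.output θ)) =
      (expval (Q.output θ) (H * H) - expval (Q.output θ) H ^ 2) / ((d : ℝ) - 1) *
        Q.qfi θ μ μ) ∧
    (∀ μ ν, ∫ V, Q.lossHess H θ μ ν V ∂(stateEnsemble (Q.output θ)) =
      (trRe H - (d : ℝ) * Q.loss H θ) / ((d : ℝ) - 1) * Q.qfi θ μ ν) ∧
    (3 ≤ d → ∀ μ ν,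
      ProbabilityTheory.variance (Q.lossHess H θ μ ν) (stateEnsemble (Q.output θ)) ≤
        32 * ((expval (Q.output θ) (H * H) - expval (Q.output θ) H ^ 2) / ((d : ℝ) - 1) +
          2 * schattenTwoNorm H ^ 2 / ((d : ℝ) * ((d : ℝ) - 2))) *
        ‖Q.generator μ‖ ^ 2 * ‖Q.generator ν‖ ^ 2) := by
  subst hd
  exact ⟨fun V => Q.contDiff_loss _,
    fun μ => memLp_two_of_continuous (Q.continuous_lossGrad hH θ μ),
    fun μ ν => memLp_two_of_continuous (Q.continuous_lossHess hH θ μ ν),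
    Q.integral_lossGrad hH θ, Q.variance_lossGrad hH θ, Q.integral_lossHess hH hd2 θ,
    fun hd3 => Q.variance_lossHess_le hH hd3 θ⟩
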